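/- Let $n\ge 3$ and let $W\ge n-2$ be a real number. Let $\widetilde D_n$ be the weighted directed graph with vertices $x_1,\dots,x_n$, edges $(x_i,x_{i+1})$ for $1\le i\le n-1$ and $(x_1,x_n)$, all of weight $1$, and the edge $(x_n,x_1)$ of weight $W$. Let $\widetilde G_n=(V,\omega)$ be its shortest-distance network: the complete directed graph on $V=\{x_1,\dots,x_n\}$ where $\omega(u,v)$ is the least total weight of a walk from $u$ to $v$ in $\widetilde D_n$. For $\delta\in\mathbb R$ consider the following simplicial complexes on $V$, each increasing in $\delta$, where $\sigma$ denotes a nonempty subset of $V$. - The Dowker sink complex: $\sigma$ is a simplex iff there is $x'\in V$ with $\omega(x,x')\le\delta$ for all $x\in\sigma$. The Dowker source complex: $\sigma$ is a simplex iff there is $x'\in V$ with $\omega(x',x)\le\delta$ for all $x\in\sigma$. - The walk-length complex: $\sigma$ is a simplex iff the infimum of the weights of the walks in $\widetilde G_n$ that contain all vertices of $\sigma$ is at most $\delta$. Fix a field $\mathbb K$. The $1$-dimensional persistence diagram of such a filtration is the multiset of the pairs of endpoints $(\inf J,\sup J)$ of the nonempty intervals $J\subseteq\mathbb R$ in a decomposition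 of the persistence module formed by the simplicial homology groups $H_1(\,\cdot\,;\mathbb K)$ of the complexes, $\delta\in\mathbb R$, and the maps induced by inclusions, as a finite direct sum of interval modules. Then these diagrams exist, are unique, and are as follows. 1. The $1$-dimensional persistence diagrams $\mathrm{Dgm}_1^{\mathfrak D}(\widetilde G_n)$ of the Dowker sink filtration and of the Dowker source filtration are both equal to $$\Big\{\big(1,\lceil (n-1)/2\rceil\big)\Big\}\quad\text{if } n\ge 4,$$ and both are empty if $n=3$ (where the point $(1,\lceil (n-1)/2\rceil)=(1,1)$ would lie on the diagonal). 2. The $1$-dimensional persistence diagram of the walk-length filtration is $\mathrm{Dgm}_1^{\mathrm{WL}}(\widetilde G_n)=\{(1,n-1)\}$. -/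

import Mathlib

set_option maxSynthPendingDepth 3

open scoped NNReal

/-! ## Weighted digraphs, walks, shortest-distance digraphs -/

/-- A weighted digraph on the vertex set `V`: a set of directed edges with nonnegative weights, the
weight of an edge being zero exactly when the edge is a self-loop. Only the values of `weight` on
edges are meaningful. -/
structure WeightedDigraph (V : Type*) extends Digraph V where
  weight : V → V → ℝ≥0
  weight_eq_zero_iff : ∀ u v, Adj u v → (weight u v = 0 ↔ u = v)

namespace WeightedDigraph

variable {V : Type*}

/-- A walk `(v₀, …, vₘ)`, `m ≥ 0`, as a nonempty list of vertices with an edge between any two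
consecutive ones. -/
def IsWalk (D : WeightedDigraph V) (γ : List V) : Prop :=
  γ ≠ [] ∧ γ.IsChain D.Adj

/-- The weight of a walk: the sum of the weights of its edges. -/
def walkWeight (D : WeightedDigraph V) (γ : List V) : ℝ≥0 :=
  (List.zipWith D.weight γ γ.tail).sum

def IsWalkFromTo (D : WeightedDigraph V) (u v : V) (γ : List V) : Prop :=
  D.IsWalk γ ∧ γ.head? = some u ∧ γ.getLast? = some v

def StronglyConnected (D : WeightedDigraph V) : Prop :=
  ∀ u v, ∃ γ, D.IsWalkFromTo u v γ

/-- The shortest distance from `u` to `v`: the least weight of a walk from `u` to `v` (on a finite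
vertex set the infimum is attained). -/
noncomputable def shortestDist (D : WeightedDigraph V) (u v : V) : ℝ≥0 :=
  sInf {r | ∃ γ, D.IsWalkFromTo u v γ ∧ D.walkWeight γ = r}

theorem exists_le_walkWeight [Finite V] (D : WeightedDigraph V) :
    ∃ m : ℝ≥0, 0 < m ∧ ∀ u v, u ≠ v → ∀ γ, D.IsWalkFromTo u v γ → m ≤ D.walkWeight γ := by
  classical
  obtain ⟨m, hm, hle⟩ : ∃ m : ℝ≥0, 0 < m ∧ ∀ u v, D.Adj u v → u ≠ v → m ≤ D.weight u v := by
    let S : Set (V × V) := {p | D.Adj p.1 p.2 ∧ p.1 ≠ p.2}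
    rcases S.eq_empty_or_nonempty with h | h
    · refine ⟨1, one_pos, fun u v ha hne => ?_⟩
      exact absurd (show (u, v) ∈ S from ⟨ha, hne⟩) (by simp [h])
    · obtain ⟨p, hp, hmin⟩ := S.toFinite.exists_minimalFor (fun p => D.weight p.1 p.2) S h
      refine ⟨D.weight p.1 p.2, ?_, fun u v ha hne => ?_⟩
      · exact pos_iff_ne_zero.2 fun h0 => hp.2 ((D.weight_eq_zero_iff _ _ hp.1).1 h0)
      · rcases le_total (D.weight p.1 p.2) (D.weight u v) with h | h
        · exact h
        · exact hmin (show (u, v) ∈ S from ⟨ha, hne⟩) h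
  refine ⟨m, hm, fun u v hne γ => ?_⟩
  induction γ generalizing u with
  | nil => rintro ⟨⟨h, -⟩, -⟩; exact absurd rfl h
  | cons a l ih =>
    rintro ⟨⟨-, hc⟩, hh, hl⟩
    obtain rfl : a = u := by simpa using hh
    cases l with
    | nil => exact absurd (by simpa using hl) hne
    | cons b l =>
      rw [List.isChain_cons_cons] at hc
      have hw : D.walkWeight (a :: b :: l) = D.weight a b + D.walkWeight (b :: l) := by
        simp [walkWeight]
      rw [hw]
      by_cases hab : a = b
      · subst hab
        exact (ih a hne ⟨⟨by simp, hc.2⟩, rfl, by simpa using hl⟩).trans le_add_self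
      · exact (hle a b hc.1 hab).trans le_self_add

/-- The shortest-distance digraph of a strongly connected weighted digraph: the complete digraph
(self-loops included) weighted by the shortest distance. -/
noncomputable def shortestDistanceDigraph [Finite V] (D : WeightedDigraph V)
    (hD : D.StronglyConnected) : WeightedDigraph V where
  Adj _ _ := True
  weight := D.shortestDist
  weight_eq_zero_iff u v _ := by
    constructor
    · intro h
      by_contra hne
      obtain ⟨m, hm, hle⟩ := D.exists_le_walkWeight
      obtain ⟨γ, hγ⟩ := hD u v
      have : m ≤ D.shortestDist u v :=
        le_csInf ⟨_, γ, hγ, rfl⟩ (by rintro _ ⟨γ', h', rfl⟩; exact hle u v hne γ' h')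
      exact absurd (this.trans_eq h) (not_le.2 hm)
    · rintro rfl
      refine le_antisymm (csInf_le (OrderBot.bddBelow _) ⟨[u], ⟨⟨by simp, by simp⟩, rfl, rfl⟩, ?_⟩)
        zero_le
      simp [walkWeight]

/-! ## The walk-length filtration and the Dowker filtrations

A filtered simplicial complex indexed by `ℝ` is a monotone map into the simplicial complexes on `V`;
not every element of `V` has to be a vertex of each complex. -/

/-- The infimum of the weights of the walks that contain all vertices in `σ`; it is `⊤` if there is
no such walk. -/
noncomputable def walkLength (D : WeightedDigraph V) (σ : Finset V) : EReal :=
  ⨅ (γ : List V) (_ : D.IsWalk γ ∧ ∀ v ∈ σ, v ∈ γ), ((D.walkWeight γ : ℝ) : EReal)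

theorem walkLength_mono (D : WeightedDigraph V) {σ τ : Finset V} (h : σ ⊆ τ) :
    D.walkLength σ ≤ D.walkLength τ :=
  le_iInf₂ fun γ hγ => iInf₂_le γ ⟨hγ.1, fun v hv => hγ.2 v (h hv)⟩

/-- The walk-length filtration: a simplex `σ` is present at `δ` iff `walkLength σ ≤ δ`. -/
noncomputable def walkLengthFiltration (D : WeightedDigraph V) :
    ℝ →o PreAbstractSimplicialComplex V where
  toFun δ :=
    { faces := {σ | σ.Nonempty ∧ D.walkLength σ ≤ (δ : EReal)}
      isRelLowerSet_faces := fun _ hσ =>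
        ⟨hσ.1, fun _ hτ hne => ⟨hne, (D.walkLength_mono hτ).trans hσ.2⟩⟩ }
  monotone' _ _ h _ hσ := ⟨hσ.1, hσ.2.trans (EReal.coe_le_coe_iff.2 h)⟩

/-- The relation `{(x, x') : ω (x, x') ≤ δ}`. -/
def dowkerRel (D : WeightedDigraph V) (δ : ℝ) (x x' : V) : Prop :=
  D.Adj x x' ∧ (D.weight x x' : ℝ) ≤ δ

def dowkerSinkFiltration (D : WeightedDigraph V) : ℝ →o PreAbstractSimplicialComplex V where
  toFun δ :=
    { faces := {σ | σ.Nonempty ∧ ∃ x', ∀ x ∈ σ, D.dowkerRel δ x x'}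
      isRelLowerSet_faces := fun _ hσ => ⟨hσ.1, fun _ hτ hne =>
        ⟨hne, hσ.2.imp fun _ hx' x hx => hx' x (hτ hx)⟩⟩ }
  monotone' _ _ h _ hσ := ⟨hσ.1, hσ.2.imp fun _ hx' x hx => ⟨(hx' x hx).1, (hx' x hx).2.trans h⟩⟩

def dowkerSourceFiltration (D : WeightedDigraph V) : ℝ →o PreAbstractSimplicialComplex V where
  toFun δ :=
    { faces := {σ | σ.Nonempty ∧ ∃ x', ∀ x ∈ σ, D.dowkerRel δ x' x}
      isRelLowerSet_faces := fun _ hσ => ⟨hσ.1, fun _ hτ hne =>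
        ⟨hne, hσ.2.imp fun _ hx' x hx => hx' x (hτ hx)⟩⟩ }
  monotone' _ _ h _ hσ := ⟨hσ.1, hσ.2.imp fun _ hx' x hx => ⟨(hx' x hx).1, (hx' x hx).2.trans h⟩⟩

end WeightedDigraph

/-! ## Simplicial homology

The vertices are linearly ordered and every simplex carries the orientation of increasing order, so
that the `k`-chains of a complex are the linear combinations of its faces with `k + 1` vertices. The
chain groups of all complexes on `V` and in all degrees live in the one space `Finset V →₀ K`. -/

namespace PreAbstractSimplicialComplex

variable (K : Type*) [Field K] {V : Type*}

/-- The space of `k`-chains. -/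
def chains (X : PreAbstractSimplicialComplex V) (k : ℕ) : Submodule K (Finset V →₀ K) :=
  Finsupp.supported K K {σ | σ ∈ X ∧ σ.card = k + 1}

theorem chains_mono {X Y : PreAbstractSimplicialComplex V} (h : X ≤ Y) (k : ℕ) :
    X.chains K k ≤ Y.chains K k :=
  Finsupp.supported_mono fun _ hσ => ⟨h hσ.1, hσ.2⟩

variable [LinearOrder V]

/-- The boundary `∂ [v₀ < ⋯ < vₖ] = ∑ i, (-1) ^ i [v₀, …, v̂ᵢ, …, vₖ]`, where `i` is the number of
vertices below `vᵢ`; the boundary of a `0`-simplex is zero. -/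
noncomputable def boundary : (Finset V →₀ K) →ₗ[K] (Finset V →₀ K) :=
  Finsupp.linearCombination K fun σ =>
    if σ.card ≤ 1 then 0
    else ∑ v ∈ σ, Finsupp.single (σ.erase v) ((-1) ^ (σ.filter (· < v)).card)

/-- The kernel of `∂ₖ`. -/
noncomputable def cycles (X : PreAbstractSimplicialComplex V) (k : ℕ) :
    Submodule K (Finset V →₀ K) :=
  X.chains K k ⊓ LinearMap.ker (boundary K)

/-- The image of `∂ₖ₊₁`. -/
noncomputable def boundaries (X : PreAbstractSimplicialComplex V) (k : ℕ) :
    Submodule K (Finset V →₀ K) :=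
  (X.chains K (k + 1)).map (boundary K)

/-- The `k`-th simplicial homology with coefficients in `K`. -/
abbrev Homology (X : PreAbstractSimplicialComplex V) (k : ℕ) :=
  ↥(X.cycles K k) ⧸ (X.boundaries K k).submoduleOf (X.cycles K k)

variable {X Y : PreAbstractSimplicialComplex V}

theorem cycles_mono (h : X ≤ Y) (k : ℕ) : X.cycles K k ≤ Y.cycles K k :=
  inf_le_inf_right _ (chains_mono K h k)

/-- The map in homology induced by an inclusion of complexes. -/
noncomputable def homologyMap (h : X ≤ Y) (k : ℕ) : X.Homology K k →ₗ[K] Y.Homology K k :=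
  Submodule.mapQ _ _ (Submodule.inclusion (cycles_mono K h k))
    fun _ hz => Submodule.map_mono (chains_mono K h (k + 1)) hz

end PreAbstractSimplicialComplex

/-! ## Persistence modules and persistence diagrams -/

/-- A persistence module over `K`, indexed by `ℝ`. -/
structure PersistenceModule (K : Type*) [Field K] where
  space : ℝ → Type*
  [addCommGroup : ∀ t, AddCommGroup (space t)]
  [module : ∀ t, Module K (space t)]
  map : ∀ {s t : ℝ}, s ≤ t → space s →ₗ[K] space t
  map_refl : ∀ t, map (le_refl t) = LinearMap.id
  map_comp : ∀ {r s t : ℝ} (hrs : r ≤ s) (hst : s ≤ t), map hst ∘ₗ map hrs = map (hrs.trans hst)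

attribute [instance] PersistenceModule.addCommGroup PersistenceModule.module

namespace PersistenceModule

/-- An isomorphism of persistence modules exists. -/
def Isomorphic {K : Type*} [Field K] (M N : PersistenceModule K) : Prop :=
  ∃ e : ∀ t, M.space t ≃ₗ[K] N.space t,
    ∀ {s t : ℝ} (h : s ≤ t) (x : M.space s), e t (M.map h x) = N.map h (e s x)

/-- The space at `t` of the interval module of `J`: all of `K` if `t ∈ J` and zero otherwise. -/
def intervalSpace (K : Type*) [Field K] (J : Set ℝ) (t : ℝ) : Submodule K K where
  carrier := {x | t ∉ J → x = 0}
  zero_mem' _ := rfl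
  add_mem' ha hb ht := by rw [ha ht, hb ht, add_zero]
  smul_mem' c x hx ht := by rw [hx ht, smul_zero]

open Classical in
/-- The interval module of an interval `J` of the real line; the maps between its nonzero spaces are
identities. -/
noncomputable def interval (K : Type*) [Field K] (J : Set ℝ) (hJ : J.OrdConnected) :
    PersistenceModule K where
  space t := intervalSpace K J t
  map {s t} _ :=
    { toFun x := ⟨if t ∈ J then x.1 else 0, fun ht => if_neg ht⟩
      map_add' x y := by
        apply Subtype.ext
        by_cases ht : t ∈ J <;> simp [ht]
      map_smul' c x := by
        apply Subtype.ext
        by_cases ht : t ∈ J <;> simp [ht] }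
  map_refl t := by
    refine LinearMap.ext fun x => Subtype.ext ?_
    by_cases ht : t ∈ J
    · simp [ht]
    · simp [ht, x.2 ht]
  map_comp {r s t} hrs hst := by
    refine LinearMap.ext fun x => Subtype.ext ?_
    by_cases ht : t ∈ J
    · by_cases hs : s ∈ J
      · simp [ht, hs]
      · have hr : r ∉ J := fun hr => hs (hJ.out hr ht ⟨hrs, hst⟩)
        simp [ht, hs, x.2 hr]
    · simp [ht]

/-- The direct sum of finitely many persistence modules. -/
def directSum {K : Type*} [Field K] {ι : Type*} [Finite ι] (M : ι → PersistenceModule K) :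
    PersistenceModule K where
  space t := ∀ i, (M i).space t
  map h := LinearMap.pi fun i => (M i).map h ∘ₗ LinearMap.proj i
  map_refl t := by
    refine LinearMap.ext fun x => funext fun i => ?_
    exact LinearMap.congr_fun ((M i).map_refl t) (x i)
  map_comp hrs hst := by
    refine LinearMap.ext fun x => funext fun i => ?_
    exact LinearMap.congr_fun ((M i).map_comp hrs hst) (x i)

/-- `P` is the persistence diagram of `M`: the multiset of the pairs of endpoints (`inf J`, `sup J`)
of the intervals in a decomposition of `M` as a finite direct sum of interval modules over nonempty
intervals `J`. -/
def IsPersistenceDiagram {K : Type*} [Field K] (M : PersistenceModule K)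
    (P : Multiset (EReal × EReal)) : Prop :=
  ∃ (m : ℕ) (J : Fin m → Set ℝ) (hJ : ∀ l, (J l).OrdConnected),
    (∀ l, (J l).Nonempty) ∧
    M.Isomorphic (directSum fun l => interval K (J l) (hJ l)) ∧
    P = Finset.univ.val.map fun l =>
      (sInf (Real.toEReal '' J l), sSup (Real.toEReal '' J l))

end PersistenceModule

/-- The `k`-dimensional persistence module of a filtered simplicial complex, with coefficients in
the field `K`. -/
noncomputable def persistentHomology (K : Type*) [Field K] {V : Type*} [LinearOrder V]
    (F : ℝ →o PreAbstractSimplicialComplex V) (k : ℕ) : PersistenceModule K where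
  space t := (F t).Homology K k
  map h := PreAbstractSimplicialComplex.homologyMap K (F.monotone h) k
  map_refl t := by
    ext x
    rfl
  map_comp _ _ := by
    ext x
    rfl

/-! ## The modified cycle graph -/

/-- The modified cycle graph on the vertices `x₁, …, xₙ`, where `xᵢ` is the element `i - 1` of
`Fin n`: the edges `(xᵢ, xᵢ₊₁)` for `1 ≤ i ≤ n - 1` and `(x₁, xₙ)` have weight `1`, and the edge
`(xₙ, x₁)` has weight `W ≥ n - 2`. -/
noncomputable def modifiedCycle (n : ℕ) (hn : 3 ≤ n) (W : ℝ≥0) (hW : (n : ℝ) - 2 ≤ W) :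
    WeightedDigraph (Fin n) where
  Adj u v := u.val + 1 = v.val ∨ (u.val = 0 ∧ v.val + 1 = n) ∨ (u.val + 1 = n ∧ v.val = 0)
  weight u v := if u.val + 1 = n ∧ v.val = 0 then W else 1
  weight_eq_zero_iff u v h := by
    have hW0 : W ≠ 0 := by
      rintro rfl
      have : (3 : ℝ) ≤ n := by exact_mod_cast hn
      simp only [NNReal.coe_zero] at hW
      linarith
    have huv : u ≠ v := by
      rintro rfl
      omega
    simp only [huv, iff_false]
    split_ifs
    · exact hW0
    · exact one_ne_zero

theorem modifiedCycle_stronglyConnected (n : ℕ) (hn : 3 ≤ n) (W : ℝ≥0) (hW : (n : ℝ) - 2 ≤ W) :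
    (modifiedCycle n hn W hW).StronglyConnected := by
  set D := modifiedCycle n hn W hW
  have up : ∀ (k : ℕ) (hk : k < n), Relation.ReflTransGen D.Adj ⟨0, by omega⟩ ⟨k, hk⟩ := by
    intro k
    induction k with
    | zero => intro _; exact .refl
    | succ k ih => intro hk; exact (ih (by omega)).tail (Or.inl rfl)
  have down : ∀ (k : ℕ) (hk : k < n),
      Relation.ReflTransGen D.Adj ⟨n - 1 - k, by omega⟩ ⟨n - 1, by omega⟩ := by
    intro k
    induction k with
    | zero => intro _; exact .refl
    | succ k ih =>
      intro hk
      exact (ih (by omega)).head (Or.inl (show n - 1 - (k + 1) + 1 = n - 1 - k by omega))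
  intro u v
  have h1 := down (n - 1 - u.val) (by omega)
  have hu : (⟨n - 1 - (n - 1 - u.val), by omega⟩ : Fin n) = u := by
    ext
    simp only
    omega
  rw [hu] at h1
  have h2 : Relation.ReflTransGen D.Adj u v :=
    (h1.tail (Or.inr (Or.inr ⟨show n - 1 + 1 = n by omega, rfl⟩))).trans (up v.val v.isLt)
  obtain ⟨l, hl, hlast⟩ := List.exists_isChain_cons_of_relationReflTransGen h2
  exact ⟨u :: l, ⟨by simp, hl⟩, rfl, by rw [List.getLast?_eq_getLast_of_ne_nil (by simp), hlast]⟩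

/-- The shortest-distance network of the modified cycle graph. -/
noncomputable def modifiedCycleNetwork (n : ℕ) (hn : 3 ≤ n) (W : ℝ≥0) (hW : (n : ℝ) - 2 ≤ W) :
    WeightedDigraph (Fin n) :=
  (modifiedCycle n hn W hW).shortestDistanceDigraph (modifiedCycle_stronglyConnected n hn W hW)

/-! One criterion, `isPersistenceDiagram_iff_of_arcs`, covers all three filtrations. Place the
vertices on the circle `0, …, n - 1`, closed by the wrap edge `{0, n - 1}`. There are no edges
before time `1`. For `1 ≤ t < k` every edge spans a simplex on one of its two arcs: the arc between
its endpoints if it is short (`b - a < k`), the arc through the wrap edge if it is long. So every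
edge is homologous to a path along its arc, and every 1-cycle to a multiple of the circle. The
multiple is read off by the winding cocycle `longEdgeSum`; it is a cocycle because a triangle whose
outer edge is long has exactly one other long edge. Hence `H₁` is a line with the same generator
throughout `[1, k)`. From time `k` on, every edge spans an arc and some edge spans both, so the
circle bounds and `H₁ = 0`. The module is the interval module of `[1, k)`, or zero if `k = 1`.

The value of `k` comes from the distances, bounded below by `cycleDist`: the step `0 → n - 1` is
cheap, and going backwards costs at least `n - 2`. In the Dowker complexes the arc of an edge at `0`
or `n - 1` and the rest of the path have total length `n - 1`, so both fit once `t ≥ ⌈(n - 1) / 2⌉ =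
⌊n / 2⌋`. For walk lengths `k = n - 1`, since a walk through `0`, `n - 1` and a third vertex weighs
at least `n - 1`. -/

/-! ### Persistence diagrams of zero modules and interval modules -/

namespace PersistenceModule

variable {K : Type*} [Field K]

theorem Isomorphic.symm {M N : PersistenceModule K} (h : M.Isomorphic N) : N.Isomorphic M := by
  obtain ⟨e, he⟩ := h
  refine ⟨fun t => (e t).symm, fun {s t} hst x => ?_⟩
  rw [LinearEquiv.symm_apply_eq, he, LinearEquiv.apply_symm_apply]

theorem Isomorphic.trans {M N P : PersistenceModule K} (h : M.Isomorphic N) (h' : N.Isomorphic P) :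
    M.Isomorphic P := by
  obtain ⟨e, he⟩ := h
  obtain ⟨e', he'⟩ := h'
  refine ⟨fun t => (e t).trans (e' t), fun {s t} hst x => ?_⟩
  simp only [LinearEquiv.trans_apply, he, he']

theorem intervalSpace_subsingleton {J : Set ℝ} {t : ℝ} (ht : t ∉ J) :
    Subsingleton (intervalSpace K J t) :=
  ⟨fun x y => Subtype.ext ((x.2 ht).trans (y.2 ht).symm)⟩

/-- A persistence module with compatible linear bijections onto the field over `J`, and zero outside
of `J`, is isomorphic to the interval module of `J`. -/
theorem isomorphic_interval (M : PersistenceModule K) (J : Set ℝ) (hJ : J.OrdConnected)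
    (f : ∀ t ∈ J, M.space t →ₗ[K] K) (hf : ∀ t ht, Function.Bijective (f t ht))
    (hcomp : ∀ {s t : ℝ} (hs : s ∈ J) (ht : t ∈ J) (h : s ≤ t) (x : M.space s),
      f t ht (M.map h x) = f s hs x)
    (h0 : ∀ t ∉ J, Subsingleton (M.space t)) : M.Isomorphic (interval K J hJ) := by
  classical
  let g : ∀ t, M.space t →ₗ[K] K := fun t => if ht : t ∈ J then f t ht else 0
  have hg : ∀ t (ht : t ∈ J), g t = f t ht := fun t ht => dif_pos ht
  let g' : ∀ t, M.space t →ₗ[K] intervalSpace K J t := fun t =>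
    (g t).codRestrict (intervalSpace K J t) fun x ht => by
      have := h0 t ht
      rw [Subsingleton.elim x 0, map_zero]
  have hg' : ∀ t, Function.Bijective (g' t) := by
    intro t
    by_cases ht : t ∈ J
    · constructor
      · intro x y hxy
        have : g t x = g t y := congrArg Subtype.val hxy
        rw [hg t ht] at this
        exact (hf t ht).1 this
      · intro y
        obtain ⟨x, hx⟩ := (hf t ht).2 y.1
        exact ⟨x, Subtype.ext (by simpa [g', hg t ht] using hx)⟩
    · have := h0 t ht
      have := intervalSpace_subsingleton (K := K) ht
      exact ⟨fun x y _ => Subsingleton.elim x y, fun y => ⟨0, Subsingleton.elim _ y⟩⟩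
  refine ⟨fun t => LinearEquiv.ofBijective (g' t) (hg' t), fun {s t} h x => ?_⟩
  refine Subtype.ext ?_
  change g t (M.map h x) = if t ∈ J then g s x else 0
  by_cases ht : t ∈ J
  · rw [if_pos ht]
    by_cases hs : s ∈ J
    · rw [hg t ht, hg s hs, hcomp hs ht h]
    · have := h0 s hs
      rw [Subsingleton.elim x 0, map_zero, map_zero, map_zero]
  · have := h0 t ht
    rw [if_neg ht, Subsingleton.elim (M.map h x) 0, map_zero]

open Classical in
/-- The canonical generator of the `l`-th summand of a direct sum of interval modules. -/
noncomputable def intervalGenerator {m : ℕ} {J : Fin m → Set ℝ} (hJ : ∀ l, (J l).OrdConnected)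
    (l : Fin m) {t : ℝ} (ht : t ∈ J l) : (directSum fun l => interval K (J l) (hJ l)).space t :=
  fun l' => (⟨if l' = l then 1 else 0, fun h => if_neg (by rintro rfl; exact h ht)⟩ :
    intervalSpace K (J l') t)

theorem intervalGenerator_ne_zero {m : ℕ} {J : Fin m → Set ℝ} (hJ : ∀ l, (J l).OrdConnected)
    (l : Fin m) {t : ℝ} (ht : t ∈ J l) : intervalGenerator (K := K) hJ l ht ≠ 0 := by
  intro h
  have h1 : (intervalGenerator (K := K) hJ l ht l : intervalSpace K (J l) t) = 0 := congrFun h l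
  have h2 : (if l = l then (1 : K) else 0) = 0 := congrArg Subtype.val h1
  rw [if_pos rfl] at h2
  exact one_ne_zero h2

theorem map_intervalGenerator_eq_zero {m : ℕ} {J : Fin m → Set ℝ}
    (hJ : ∀ l, (J l).OrdConnected) (l : Fin m) {s t : ℝ} (hs : s ∈ J l) (ht : t ∉ J l)
    (h : s ≤ t) :
    (directSum fun l => interval K (J l) (hJ l)).map h (intervalGenerator hJ l hs) = 0 := by
  classical
  funext l'
  refine Subtype.ext ?_
  change (if t ∈ J l' then (if l' = l then (1 : K) else 0) else 0) = 0
  by_cases hl : l' = l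
  · subst hl
    rw [if_neg ht]
  · simp [hl]

theorem isPersistenceDiagram_iff_of_subsingleton {M : PersistenceModule K}
    (h0 : ∀ t, Subsingleton (M.space t)) (P : Multiset (EReal × EReal)) :
    M.IsPersistenceDiagram P ↔ P = 0 := by
  constructor
  · rintro ⟨m, J, hJ, hne, ⟨e, -⟩, rfl⟩
    cases m with
    | zero => rfl
    | succ m =>
      obtain ⟨t, ht⟩ := hne 0
      have := h0 t
      exact absurd ((e t).symm.subsingleton.elim _ _) (intervalGenerator_ne_zero (K := K) hJ 0 ht)
  · rintro rfl
    refine ⟨0, Fin.elim0, fun l => l.elim0, fun l => l.elim0, ?_, rfl⟩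
    have h1 : ∀ t, Subsingleton ((directSum fun l : Fin 0 =>
        interval K (Fin.elim0 l) l.elim0).space t) :=
      fun t => ⟨fun x y => funext fun l => l.elim0⟩
    refine ⟨fun t =>
      { toFun := fun _ => 0
        invFun := fun _ => 0
        map_add' := fun _ _ => (h1 t).elim _ _
        map_smul' := fun _ _ => (h1 t).elim _ _
        left_inv := fun _ => (h0 t).elim _ _
        right_inv := fun _ => (h1 t).elim _ _ }, fun {s t} h x => (h1 t).elim _ _⟩

/-- Uniqueness needs no general decomposition theorem here: following the generators of the summands
into spaces of dimension at most one shows that there is a single summand, with interval `J₀`. -/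
theorem isPersistenceDiagram_iff_of_isomorphic_interval {M : PersistenceModule K}
    {J₀ : Set ℝ} (hJ₀ : J₀.OrdConnected) (hne₀ : J₀.Nonempty)
    (hM : M.Isomorphic (interval K J₀ hJ₀)) (P : Multiset (EReal × EReal)) :
    M.IsPersistenceDiagram P ↔
      P = {(sInf (Real.toEReal '' J₀), sSup (Real.toEReal '' J₀))} := by
  classical
  constructor
  · rintro ⟨m, J, hJ, hne, hM', rfl⟩
    obtain ⟨e, he⟩ := hM'.symm.trans hM
    have hgen : ∀ l t (ht : t ∈ J l), e t (intervalGenerator hJ l ht) ≠ 0 := fun l t ht h =>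
      intervalGenerator_ne_zero hJ l ht ((e t).map_eq_zero_iff.1 h)
    have hsub : ∀ l, J l ⊆ J₀ := by
      intro l t ht
      by_contra hn
      exact hgen l t ht ((intervalSpace_subsingleton hn).elim _ _)
    have hex : ∀ t ∈ J₀, ∃ l, t ∈ J l := by
      intro t ht
      by_contra! hn
      let y : (interval K J₀ hJ₀).space t :=
        (⟨1, fun h => absurd ht h⟩ : intervalSpace K J₀ t)
      have h1 : (e t).symm y = 0 :=
        funext fun l => (intervalSpace_subsingleton (hn l)).elim _ _
      have h2 : y = 0 := (e t).symm.map_eq_zero_iff.1 h1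
      exact one_ne_zero (congrArg Subtype.val h2)
    -- Generators of two summands alive at `t` would be independent, but their images lie in a line:
    -- `b • x - a • y` is sent to zero, and its `l`-th coordinate gives `b = 0`.
    have huniq : ∀ t l l', t ∈ J l → t ∈ J l' → l = l' := by
      intro t l l' hl hl'
      by_contra hll
      set x := intervalGenerator (K := K) hJ l hl
      set y := intervalGenerator (K := K) hJ l' hl'
      let a : intervalSpace K J₀ t := e t x
      let b : intervalSpace K J₀ t := e t y
      have h1 : e t (b.1 • x - a.1 • y) = 0 := by
        rw [map_sub, map_smul, map_smul]
        refine Subtype.ext ?_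
        change b.1 * a.1 - a.1 * b.1 = 0
        ring
      rw [LinearEquiv.map_eq_zero_iff] at h1
      have h2 := congrFun h1 l
      have h3 : b.1 * (if l = l then 1 else 0) - a.1 * (if l = l' then 1 else 0) = 0 :=
        congrArg Subtype.val h2
      rw [if_pos rfl, if_neg hll, mul_one, mul_zero, sub_zero] at h3
      exact hgen l' t hl' (Subtype.ext h3)
    -- The structure maps of the interval module are injective between times of `J₀`, so no summand
    -- can die inside `J₀`.
    have hup : ∀ l s t, s ≤ t → s ∈ J l → t ∈ J₀ → t ∈ J l := by
      intro l s t hst hs ht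
      by_contra hn
      have h1 := he hst (intervalGenerator hJ l hs)
      rw [map_intervalGenerator_eq_zero hJ l hs hn hst, map_zero] at h1
      have h2 : (0 : K) = if t ∈ J₀ then
          (show intervalSpace K J₀ s from e s (intervalGenerator hJ l hs)).1 else 0 :=
        congrArg Subtype.val h1
      rw [if_pos ht] at h2
      exact hgen l s hs (Subtype.ext h2.symm)
    have heq : ∀ l, J l = J₀ := by
      intro l
      refine (hsub l).antisymm fun s hs => ?_
      obtain ⟨t, ht⟩ := hne l
      rcases le_total t s with hts | hst
      · exact hup l t s hts ht hs
      · obtain ⟨l', hl'⟩ := hex s hs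
        rwa [huniq t l l' ht (hup l' s t hst hl' (hsub l ht))]
    obtain ⟨t₀, ht₀⟩ := hne₀
    obtain ⟨l₀, -⟩ := hex t₀ ht₀
    have hl : ∀ l, l = l₀ := fun l => huniq t₀ l l₀ (heq l ▸ ht₀) (heq l₀ ▸ ht₀)
    have huniv : (Finset.univ : Finset (Fin m)) = {l₀} := by
      ext l
      simp [hl l]
    rw [huniv, Finset.singleton_val, Multiset.map_singleton, heq]
  · rintro rfl
    refine ⟨1, fun _ => J₀, fun _ => hJ₀, fun _ => hne₀, hM.trans ?_, by simp⟩
    refine ⟨fun t =>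
      { toFun := fun x _ => x
        invFun := fun x => x 0
        map_add' := fun _ _ => rfl
        map_smul' := fun _ _ => rfl
        left_inv := fun _ => rfl
        right_inv := fun x => funext fun l => by rw [Subsingleton.elim l 0] },
      fun {s t} h x => rfl⟩

end PersistenceModule

/-! ### Simplicial 1-cycles and 1-boundaries -/

namespace PreAbstractSimplicialComplex

variable (K : Type*) [Field K]

section General

variable {V : Type*} [LinearOrder V] {X : PreAbstractSimplicialComplex V}

theorem boundary_single_pair {a b : V} (h : a < b) :
    boundary K (Finsupp.single {a, b} 1) = Finsupp.single {b} 1 - Finsupp.single {a} 1 := by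
  have hab := h.ne
  have e1 : ({a, b} : Finset V).erase a = {b} := by ext x; simp; grind
  have e2 : ({a, b} : Finset V).erase b = {a} := by ext x; simp; grind
  have f1 : ({a, b} : Finset V).filter (· < a) = ∅ := by ext x; simp; grind
  have f2 : ({a, b} : Finset V).filter (· < b) = {a} := by ext x; simp; grind
  rw [boundary, Finsupp.linearCombination_single, one_smul, Finset.card_pair hab,
    if_neg (by norm_num), Finset.sum_pair hab, e1, e2, f1, f2]
  simp [sub_eq_add_neg]

theorem boundary_single_triple {a b c : V} (hab : a < b) (hbc : b < c) :
    boundary K (Finsupp.single {a, b, c} 1) =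
      Finsupp.single {b, c} 1 - Finsupp.single {a, c} 1 + Finsupp.single {a, b} 1 := by
  have hac := hab.trans hbc
  have e1 : ({a, b, c} : Finset V).erase a = {b, c} := by ext x; simp; grind
  have e2 : ({a, b, c} : Finset V).erase b = {a, c} := by ext x; simp; grind
  have e3 : ({a, b, c} : Finset V).erase c = {a, b} := by ext x; simp; grind
  have f1 : ({a, b, c} : Finset V).filter (· < a) = ∅ := by ext x; simp; grind
  have f2 : ({a, b, c} : Finset V).filter (· < b) = {a} := by ext x; simp; grind
  have f3 : ({a, b, c} : Finset V).filter (· < c) = {a, b} := by ext x; simp; grind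
  have hcard : ({a, b, c} : Finset V).card = 3 := Finset.card_eq_three.2
    ⟨a, b, c, hab.ne, hac.ne, hbc.ne, rfl⟩
  rw [boundary, Finsupp.linearCombination_single, one_smul, hcard,
    if_neg (by norm_num), Finset.sum_insert (by simp [hab.ne, hac.ne]), Finset.sum_pair hbc.ne,
    e1, e2, e3, f1, f2, f3, Finset.card_pair hab.ne]
  simp [sub_eq_add_neg, add_assoc]

theorem exists_pair_of_card {σ : Finset V} (h : σ.card = 2) : ∃ a b, a < b ∧ σ = {a, b} := by
  obtain ⟨a, b, hab, rfl⟩ := Finset.card_eq_two.1 h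
  rcases hab.lt_or_gt with h | h
  · exact ⟨a, b, h, rfl⟩
  · exact ⟨b, a, h, Finset.pair_comm a b⟩

theorem exists_triple_of_card {σ : Finset V} (h : σ.card = 3) :
    ∃ a b c, a < b ∧ b < c ∧ σ = {a, b, c} := by
  obtain ⟨a, ha, hmin⟩ := σ.exists_min_image id (Finset.card_pos.1 (by omega))
  have h2 : (σ.erase a).card = 2 := by rw [Finset.card_erase_of_mem ha, h]
  obtain ⟨b, c, hbc, hs⟩ := exists_pair_of_card h2
  have hb : b ∈ σ.erase a := by simp [hs]
  refine ⟨a, b, c, lt_of_le_of_ne (hmin b (Finset.mem_of_mem_erase hb))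
    (Finset.ne_of_mem_erase hb).symm, hbc, ?_⟩
  rw [← Finset.insert_erase ha, hs]

omit [LinearOrder V] in
theorem mem_of_subset {σ τ : Finset V} {v : V} (hσ : σ ∈ X) (h : τ ⊆ σ) (hv : v ∈ τ) : τ ∈ X :=
  (X.isRelLowerSet_faces hσ).2 h ⟨v, hv⟩

/-- The boundary of a triangle vanishes in homology. -/
theorem triangle_mem_boundaries {a b c : V} (hab : a < b) (hbc : b < c)
    (hX : ({a, b, c} : Finset V) ∈ X) :
    (Finsupp.single {b, c} 1 - Finsupp.single {a, c} 1 + Finsupp.single {a, b} 1 :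
      Finset V →₀ K) ∈ X.boundaries K 1 := by
  rw [← boundary_single_triple K hab hbc]
  refine Submodule.mem_map_of_mem (Finsupp.single_mem_supported K _ ⟨hX, ?_⟩)
  exact Finset.card_eq_three.2 ⟨a, b, c, hab.ne, (hab.trans hbc).ne, hbc.ne, rfl⟩

variable {K}

/-- A linear map sends `1`-chains into a subspace if it does so with every edge. -/
theorem map_mem_of_edges {E : Type*} [AddCommGroup E] [Module K E] (T : (Finset V →₀ K) →ₗ[K] E)
    (B : Submodule K E)
    (hT : ∀ a b : V, a < b → ({a, b} : Finset V) ∈ X → T (Finsupp.single {a, b} 1) ∈ B)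
    {z : Finset V →₀ K} (hz : z ∈ X.chains K 1) : T z ∈ B := by
  have : X.chains K 1 ≤ B.comap T := by
    rw [chains, Finsupp.supported_eq_span_single, Submodule.span_le]
    rintro _ ⟨σ, ⟨hσ, hc⟩, rfl⟩
    obtain ⟨a, b, hab, rfl⟩ := exists_pair_of_card hc
    exact hT a b hab hσ
  exact this hz

/-- A linear functional vanishes on `1`-boundaries if it is a cocycle on every triangle. -/
theorem eq_zero_of_mem_boundaries (φ : (Finset V →₀ K) →ₗ[K] K)
    (hφ : ∀ a b c : V, a < b → b < c → ({a, b, c} : Finset V) ∈ X →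
      φ (Finsupp.single {b, c} 1) - φ (Finsupp.single {a, c} 1) + φ (Finsupp.single {a, b} 1) = 0)
    {z : Finset V →₀ K} (hz : z ∈ X.boundaries K 1) : φ z = 0 := by
  have : X.boundaries K 1 ≤ LinearMap.ker φ := by
    rw [boundaries, chains, Finsupp.supported_eq_span_single, Submodule.map_span, Submodule.span_le]
    rintro _ ⟨_, ⟨σ, ⟨hσ, hc⟩, rfl⟩, rfl⟩
    obtain ⟨a, b, c, hab, hbc, rfl⟩ := exists_triple_of_card hc
    rw [boundary_single_triple K hab hbc]
    simpa using hφ a b c hab hbc hσ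
  exact this hz

/-- If every edge `[a, b]` is homologous to `P b - P a + φ [a, b] • C`, then every `1`-cycle `z` is
homologous to `φ z • C`. -/
theorem sub_smul_mem_boundaries (P : V → Finset V →₀ K) (φ : (Finset V →₀ K) →ₗ[K] K)
    (C : Finset V →₀ K)
    (h : ∀ a b : V, a < b → ({a, b} : Finset V) ∈ X →
      Finsupp.single {a, b} 1 - (P b - P a) - φ (Finsupp.single {a, b} 1) • C ∈ X.boundaries K 1)
    {z : Finset V →₀ K} (hz : z ∈ X.cycles K 1) : z - φ z • C ∈ X.boundaries K 1 := by
  -- `Q` sends `∂[a, b]` to `P b - P a`; only its values on single vertices matter. On a cycle the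
  -- term `Q ∘ ∂` vanishes.
  let Q : (Finset V →₀ K) →ₗ[K] (Finset V →₀ K) :=
    Finsupp.linearCombination K fun σ => ∑ v ∈ σ, P v
  let T : (Finset V →₀ K) →ₗ[K] (Finset V →₀ K) :=
    LinearMap.id - Q ∘ₗ boundary K - φ.smulRight C
  have hT := map_mem_of_edges (X := X) T (X.boundaries K 1) (fun a b hab hX => by
    simpa [T, Q, boundary_single_pair K hab] using h a b hab hX) hz.1
  have hb : boundary K z = 0 := hz.2
  simpa [T, hb] using hT

end General

/-! ### Edges as paths along the circle -/

section Cyclic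

variable {n : ℕ} {X : PreAbstractSimplicialComplex (Fin n)}

/-- The path `[0, 1] + [1, 2] + ⋯ + [j - 1, j]`. -/
noncomputable def pathChain (n j : ℕ) : Finset (Fin n) →₀ K :=
  ∑ i ∈ Finset.range j,
    Finsupp.single (Finset.univ.filter fun v : Fin n => v.val = i ∨ v.val = i + 1) 1

theorem pathChain_succ {u v : Fin n} (h : u.val + 1 = v.val) :
    pathChain K n v = pathChain K n u + Finsupp.single {u, v} 1 := by
  have : (Finset.univ.filter fun w : Fin n => w.val = u.val ∨ w.val = u.val + 1) = {u, v} := by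
    ext w
    simp [Fin.ext_iff, h]
  rw [pathChain, ← h, Finset.sum_range_succ, this, pathChain]

/-- The cycle that runs once around the circle `0, 1, …, n - 1`, with reversed orientation. -/
noncomputable def circleChain (hn : 0 < n) : Finset (Fin n) →₀ K :=
  Finsupp.single {⟨0, hn⟩, ⟨n - 1, by omega⟩} 1 - pathChain K n (n - 1)

theorem boundary_pathChain (hn : 0 < n) (v : Fin n) :
    boundary K (pathChain K n v) = Finsupp.single {v} 1 - Finsupp.single {⟨0, hn⟩} 1 := by
  obtain ⟨j, hj⟩ := v
  induction j with
  | zero => simp [pathChain]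
  | succ j ih =>
    rw [pathChain_succ K (u := ⟨j, by omega⟩) rfl, map_add, ih,
      boundary_single_pair K (Fin.mk_lt_mk.2 (Nat.lt_succ_self j))]
    abel

theorem boundary_circleChain (hn : 2 ≤ n) : boundary K (circleChain K (n := n) (by omega)) = 0 := by
  have := boundary_pathChain K (by omega) (⟨n - 1, by omega⟩ : Fin n)
  simp only at this
  rw [circleChain, map_sub, this,
    boundary_single_pair K (Fin.mk_lt_mk.2 (by omega : 0 < n - 1)), sub_self]

theorem pathChain_mem_chains (h1 : ∀ u v : Fin n, u.val + 1 = v.val → {u, v} ∈ X) (v : Fin n) :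
    pathChain K n v ∈ X.chains K 1 := by
  obtain ⟨j, hj⟩ := v
  induction j with
  | zero => simp [pathChain]
  | succ j ih =>
    rw [pathChain_succ K (u := ⟨j, by omega⟩) rfl]
    refine add_mem (ih _) (Finsupp.single_mem_supported K _ ⟨h1 _ _ rfl, ?_⟩)
    exact Finset.card_pair (by simp)

theorem circleChain_mem_cycles (hn : 2 ≤ n) (h1 : ∀ u v : Fin n, u.val + 1 = v.val → {u, v} ∈ X)
    (h2 : {⟨0, by omega⟩, ⟨n - 1, by omega⟩} ∈ X) :
    circleChain K (n := n) (by omega) ∈ X.cycles K 1 := by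
  refine ⟨sub_mem (Finsupp.single_mem_supported K _ ⟨h2, ?_⟩)
    (pathChain_mem_chains K h1 ⟨n - 1, by omega⟩), boundary_circleChain K hn⟩
  exact Finset.card_pair (by simp; omega)

/-- The path from `a` to `b` is coned off from `a`: each step from `b` to `b + 1` adds the triangle
`{a, b, b + 1}`. -/
theorem single_sub_pathChain_mem {a b : Fin n} (hab : a < b) (hX : Finset.Icc a b ∈ X) :
    Finsupp.single {a, b} 1 - (pathChain K n b - pathChain K n a) ∈ X.boundaries K 1 := by
  obtain ⟨b, hb⟩ := b
  induction b with
  | zero => exact absurd hab (by simp [Fin.lt_def])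
  | succ b ih =>
    have hs := pathChain_succ K (u := ⟨b, by omega⟩) (v := ⟨b + 1, hb⟩) rfl
    rcases Nat.lt_or_ge a.val b with h | h
    · have ih' := ih (by omega) (Fin.lt_def.2 h) (mem_of_subset hX
        (by rw [Finset.subset_iff]; intro x; simp only [Finset.mem_Icc, Fin.le_def]; omega)
        (v := a) (by simp [Fin.le_def]; omega))
      have ht := triangle_mem_boundaries K (X := X) (a := a) (b := ⟨b, by omega⟩)
        (c := ⟨b + 1, hb⟩) (Fin.lt_def.2 h) (by simp [Fin.lt_def]) (mem_of_subset hX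
          (by rw [Finset.subset_iff]; intro x; simp only [Finset.mem_Icc, Finset.mem_insert,
          Finset.mem_singleton, Fin.le_def, Fin.ext_iff]; omega) (v := a) (by simp))
      rw [hs]
      convert sub_mem ih' ht using 1
      abel
    · have ha : a = ⟨b, by omega⟩ :=
        Fin.ext (by have := Fin.lt_def.1 hab; simp at this ⊢; omega)
      rw [hs, ha]
      simp

/-- The edge is pushed across the complementary arc, through `0` and `n - 1`; compared with the
direct path this costs one turn of the circle. -/
theorem single_sub_circleChain_mem {a b : Fin n} (hab : a < b)
    (hX : Finset.Iic a ∪ Finset.Ici b ∈ X) :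
    Finsupp.single {a, b} 1 - (pathChain K n b - pathChain K n a) -
      circleChain K (n := n) a.pos ∈ X.boundaries K 1 := by
  have h0 := a.pos
  have hlt := Fin.lt_def.1 hab
  set o : Fin n := ⟨0, h0⟩ with ho
  set N : Fin n := ⟨n - 1, by omega⟩ with hN
  have hC : circleChain K (n := n) h0 = Finsupp.single {o, N} 1 - pathChain K n N := rfl
  have ho0 : pathChain K n o = 0 := by simp [pathChain, ho]
  -- The part of the arc below `a`: the triangle `{o, a, N}` and the path from `o` to `a`. It
  -- degenerates if `a = o`.
  have hA : Finsupp.single {a, N} 1 + pathChain K n a - Finsupp.single {o, N} 1 ∈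
      X.boundaries K 1 := by
    rcases Nat.eq_zero_or_pos a.val with h | h
    · have ha : a = o := Fin.ext h
      simp [ha, ho0]
    · have h1 := single_sub_pathChain_mem K (X := X) (a := o) (b := a) (Fin.lt_def.2 h)
        (mem_of_subset hX (by
          rw [Finset.subset_iff]; intro x; simp only [Finset.mem_Icc, Finset.mem_union,
          Finset.mem_Iic, Finset.mem_Ici, Fin.le_def, ho]; omega) (v := a) (by simp [Fin.le_def, ho]))
      have h2 := triangle_mem_boundaries K (X := X) (a := o) (b := a) (c := N)
        (Fin.lt_def.2 h) (Fin.lt_def.2 (by simp [hN]; omega)) (mem_of_subset hX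
          (by rw [Finset.subset_iff]; intro x; simp only [Finset.mem_insert, Finset.mem_singleton,
          Finset.mem_union, Finset.mem_Iic, Finset.mem_Ici, Fin.le_def, Fin.ext_iff, ho, hN]; omega)
          (v := a) (by simp))
      rw [ho0] at h1
      convert sub_mem h2 h1 using 1
      abel
  -- The part above `b`: the triangle `{a, b, N}` and the path from `b` to `N`. It degenerates if `b
  -- = N`.
  have hB : Finsupp.single {a, b} 1 - Finsupp.single {a, N} 1 + (pathChain K n N - pathChain K n b)
      ∈ X.boundaries K 1 := by
    rcases Nat.lt_or_ge b.val N.val with h | h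
    · have h1 := single_sub_pathChain_mem K (X := X) (a := b) (b := N) (Fin.lt_def.2 h)
        (mem_of_subset hX (by
          rw [Finset.subset_iff]; intro x; simp only [Finset.mem_Icc, Finset.mem_union,
          Finset.mem_Iic, Finset.mem_Ici, Fin.le_def, hN]; omega)
          (v := b) (by simp [Fin.le_def, hN]; omega))
      have h2 := triangle_mem_boundaries K (X := X) (a := a) (b := b) (c := N)
        hab (Fin.lt_def.2 h) (mem_of_subset hX
          (by rw [Finset.subset_iff]; intro x; simp only [Finset.mem_insert, Finset.mem_singleton,
          Finset.mem_union, Finset.mem_Iic, Finset.mem_Ici, Fin.le_def, Fin.ext_iff, hN]; omega)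
          (v := a) (by simp))
      convert sub_mem h2 h1 using 1
      abel
    · have hb : b = N := Fin.ext (by simp [hN] at h ⊢; omega)
      simp [hb]
  rw [hC]
  convert add_mem hA hB using 1
  abel

end Cyclic

end PreAbstractSimplicialComplex

/-! ### The winding cocycle and vanishing of the first homology -/

namespace PreAbstractSimplicialComplex

variable {K : Type*} [Field K]

theorem homology_subsingleton {V : Type*} [LinearOrder V] {X : PreAbstractSimplicialComplex V}
    {k : ℕ} (h : X.cycles K k ≤ X.boundaries K k) : Subsingleton (X.Homology K k) := by
  rw [Submodule.Quotient.subsingleton_iff, Submodule.submoduleOf,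
    Submodule.comap_subtype_eq_top]
  exact h

variable {n : ℕ}

open Classical in
variable (K) in
/-- The sum of the coefficients of the edges `[a, b]` with `a + k ≤ b`. -/
noncomputable def longEdgeSum (n k : ℕ) : (Finset (Fin n) →₀ K) →ₗ[K] K :=
  Finsupp.linearCombination K fun σ => if ∃ a ∈ σ, ∃ b ∈ σ, a.val + k ≤ b.val then 1 else 0

theorem longEdgeSum_pair {k : ℕ} (hk : 1 ≤ k) {a b : Fin n} (hab : a < b) :
    longEdgeSum K n k (Finsupp.single {a, b} 1) = if a.val + k ≤ b.val then 1 else 0 := by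
  have h := Fin.lt_def.1 hab
  rw [longEdgeSum, Finsupp.linearCombination_single, one_smul]
  congr 1
  simp only [Finset.mem_insert, Finset.mem_singleton, exists_eq_or_imp, exists_eq_left, eq_iff_iff]
  omega

theorem longEdgeSum_pathChain {k : ℕ} (hk : 2 ≤ k) (v : Fin n) :
    longEdgeSum K n k (pathChain K n v) = 0 := by
  obtain ⟨j, hj⟩ := v
  induction j with
  | zero => simp [pathChain]
  | succ j ih =>
    rw [pathChain_succ K (u := ⟨j, by omega⟩) rfl, map_add, ih,
      longEdgeSum_pair (by omega) (Fin.mk_lt_mk.2 (Nat.lt_succ_self j)), if_neg (by simp; omega),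
      add_zero]

theorem longEdgeSum_circleChain {k : ℕ} (hk : 2 ≤ k) (hkn : k ≤ n - 1) :
    longEdgeSum K n k (circleChain K (n := n) (by omega)) = 1 := by
  have h := longEdgeSum_pathChain (K := K) hk (⟨n - 1, by omega⟩ : Fin n)
  simp only at h
  rw [circleChain, map_sub, h, longEdgeSum_pair (by omega) (Fin.mk_lt_mk.2 (by omega)),
    if_pos (by simpa using hkn), sub_zero]

/-- The first homology vanishes if every edge spans either the simplex of the vertices between its
endpoints or the simplex of the others, and some edge spans both. -/
theorem cycles_le_boundaries {X : PreAbstractSimplicialComplex (Fin n)}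
    (h : ∀ a b : Fin n, a < b → {a, b} ∈ X → Finset.Icc a b ∈ X ∨ Finset.Iic a ∪ Finset.Ici b ∈ X)
    (h' : ∃ a b : Fin n, a < b ∧ Finset.Icc a b ∈ X ∧ Finset.Iic a ∪ Finset.Ici b ∈ X) :
    X.cycles K 1 ≤ X.boundaries K 1 := by
  intro z hz
  obtain ⟨a₀, b₀, hab₀, h1, h2⟩ := h'
  -- The edge that spans both arcs is homologous to both paths, whose difference is the circle.
  have hC : circleChain K (n := n) a₀.pos ∈ X.boundaries K 1 := by
    convert sub_mem (single_sub_pathChain_mem K hab₀ h1) (single_sub_circleChain_mem K hab₀ h2)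
      using 1
    abel
  have := sub_smul_mem_boundaries (X := X) (fun v => pathChain K n v) 0 0 (fun a b hab hX => by
    rw [smul_zero, sub_zero]
    rcases h a b hab hX with h | h
    · exact single_sub_pathChain_mem K hab h
    · convert add_mem (single_sub_circleChain_mem K hab h) hC using 1
      abel) hz
  simpa using this

end PreAbstractSimplicialComplex

/-! ### The diagram of a filtration by arcs -/

theorem sInf_coe_Ico {c : ℝ} (hc : 1 < c) : sInf (Real.toEReal '' Set.Ico 1 c) = 1 := by
  refine IsLeast.csInf_eq ⟨⟨1, ⟨le_rfl, hc⟩, rfl⟩, ?_⟩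
  rintro _ ⟨x, hx, rfl⟩
  exact EReal.coe_le_coe_iff.2 hx.1

theorem sSup_coe_Ico {c : ℝ} (hc : 1 < c) : sSup (Real.toEReal '' Set.Ico 1 c) = c := by
  refine sSup_eq_of_forall_le_of_forall_lt_exists_gt ?_ fun w hw => ?_
  · rintro _ ⟨x, hx, rfl⟩
    exact EReal.coe_le_coe_iff.2 hx.2.le
  · obtain ⟨r, hwr, hrc⟩ := EReal.lt_iff_exists_real_btwn.1 hw
    refine ⟨_, ⟨max 1 r, ⟨le_max_left _ _, max_lt hc (EReal.coe_lt_coe_iff.1 hrc)⟩, rfl⟩, ?_⟩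
    exact hwr.trans_le (EReal.coe_le_coe_iff.2 (le_max_right _ _))

open PreAbstractSimplicialComplex in
/-- The first persistence diagram of a filtered complex on a circle of `n` vertices, all of whose
edges span an arc, of length less than `k` or containing the step from `n - 1` to `0`. -/
theorem isPersistenceDiagram_iff_of_arcs (K : Type*) [Field K] {n : ℕ}
    (F : ℝ →o PreAbstractSimplicialComplex (Fin n)) (k : ℕ) (hk1 : 1 ≤ k) (hkn : k ≤ n - 1)
    (h0 : ∀ t < 1, ∀ a b : Fin n, a < b → {a, b} ∉ F t)
    (hpath : ∀ u v : Fin n, u.val + 1 = v.val → {u, v} ∈ F 1)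
    (hwrap : ∀ u v : Fin n, u.val = 0 → v.val = n - 1 → {u, v} ∈ F 1)
    (hedge : ∀ t : ℝ, 1 ≤ t → t < k → ∀ a b : Fin n, a < b → {a, b} ∈ F t →
      (b.val < a.val + k → Finset.Icc a b ∈ F t) ∧
        (a.val + k ≤ b.val → Finset.Iic a ∪ Finset.Ici b ∈ F t))
    (htri : ∀ t : ℝ, 1 ≤ t → t < k → ∀ a b c : Fin n, a < b → b < c → {a, b, c} ∈ F t →
      a.val + k ≤ c.val → (a.val + k ≤ b.val ↔ c.val < b.val + k))
    (hlate : ∀ t : ℝ, k ≤ t → (∀ a b : Fin n, a < b → {a, b} ∈ F t →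
      Finset.Icc a b ∈ F t ∨ Finset.Iic a ∪ Finset.Ici b ∈ F t) ∧
        ∃ a b : Fin n, a < b ∧ Finset.Icc a b ∈ F t ∧ Finset.Iic a ∪ Finset.Ici b ∈ F t)
    (P : Multiset (EReal × EReal)) :
    (persistentHomology K F 1).IsPersistenceDiagram P ↔
      P = if k = 1 then 0 else {(1, ((k : ℝ) : EReal))} := by
  have hout : ∀ t ∉ Set.Ico (1 : ℝ) k, Subsingleton ((F t).Homology K 1) := by
    intro t ht
    apply homology_subsingleton
    rcases lt_or_ge t 1 with h | h
    · intro z hz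
      have : z ∈ _ := map_mem_of_edges (X := F t) LinearMap.id
        (⊥ : Submodule K (Finset (Fin n) →₀ K))
        (fun a b hab hX => absurd hX (h0 t h a b hab)) hz.1
      rw [(Submodule.mem_bot K).1 this]
      exact zero_mem _
    · have := hlate t (not_lt.1 fun h' => ht ⟨h, h'⟩)
      exact cycles_le_boundaries this.1 this.2
  -- For `k = 1` the steps of the path would count as long, so the cocycle is useless; but `[1, k)`
  -- is empty and the module is zero.
  by_cases hk : k = 1
  · rw [if_pos hk]
    refine PersistenceModule.isPersistenceDiagram_iff_of_subsingleton (fun t => hout t ?_) P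
    simp [hk]
  have hk2 : 2 ≤ k := by omega
  have hk' : (1 : ℝ) < k := by exact_mod_cast hk2
  rw [if_neg hk]
  have hbd : ∀ t ∈ Set.Ico (1 : ℝ) k, ∀ z ∈ (F t).boundaries K 1, longEdgeSum K n k z = 0 := by
    intro t ht z hz
    refine eq_zero_of_mem_boundaries _ (fun a b c hab hbc hX => ?_) hz
    rw [longEdgeSum_pair hk1 hab, longEdgeSum_pair hk1 hbc, longEdgeSum_pair hk1 (hab.trans hbc)]
    have := htri t ht.1 ht.2 a b c hab hbc hX
    have := Fin.lt_def.1 hab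
    have := Fin.lt_def.1 hbc
    split_ifs <;> first | omega | simp
  have hcyc : ∀ t ∈ Set.Ico (1 : ℝ) k, ∀ z ∈ (F t).cycles K 1, longEdgeSum K n k z = 0 →
      z ∈ (F t).boundaries K 1 := by
    intro t ht z hz hφ
    have := sub_smul_mem_boundaries (X := F t) (fun v => pathChain K n v) (longEdgeSum K n k)
      (circleChain K (n := n) (by omega)) (fun a b hab hX => by
        obtain ⟨h1, h2⟩ := hedge t ht.1 ht.2 a b hab hX
        rw [longEdgeSum_pair hk1 hab]
        split_ifs with h
        · rw [one_smul]
          exact single_sub_circleChain_mem K hab (h2 h)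
        · rw [zero_smul, sub_zero]
          exact single_sub_pathChain_mem K hab (h1 (by omega))) hz
    simpa [hφ] using this
  have hmem : ∀ t ∈ Set.Ico (1 : ℝ) k, circleChain K (n := n) (by omega) ∈ (F t).cycles K 1 :=
    fun t ht => cycles_mono K (F.monotone ht.1) 1 (circleChain_mem_cycles K (by omega) hpath
      (hwrap _ _ rfl rfl))
  have hiso : (persistentHomology K F 1).Isomorphic
      (PersistenceModule.interval K (Set.Ico (1 : ℝ) k) Set.ordConnected_Ico) := by
    refine PersistenceModule.isomorphic_interval _ _ _
      (fun t ht => Submodule.liftQ _ (longEdgeSum K n k ∘ₗ ((F t).cycles K 1).subtype)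
        fun z hz => hbd t ht z.1 hz) (fun t ht => ⟨?_, ?_⟩) ?_ hout
    · refine (injective_iff_map_eq_zero _).2 fun x => ?_
      induction x using Submodule.Quotient.induction_on with
      | H z =>
        intro hz
        exact (Submodule.Quotient.mk_eq_zero _).2 (hcyc t ht z.1 z.2 hz)
    · intro c
      refine ⟨Submodule.Quotient.mk (c • ⟨_, hmem t ht⟩), ?_⟩
      change longEdgeSum K n k (c • circleChain K _) = c
      rw [map_smul, longEdgeSum_circleChain hk2 hkn, smul_eq_mul, mul_one]
    · intro s t hs ht h x
      induction x using Submodule.Quotient.induction_on with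
      | H z => rfl
  rw [PersistenceModule.isPersistenceDiagram_iff_of_isomorphic_interval _
    (Set.nonempty_Ico.2 hk') hiso, sInf_coe_Ico hk', sSup_coe_Ico hk']

/-! ### Walks and shortest distances -/

namespace WeightedDigraph

section Walks

variable {V : Type*} (D : WeightedDigraph V)

theorem walkWeight_cons_cons (a b : V) (l : List V) :
    D.walkWeight (a :: b :: l) = D.weight a b + D.walkWeight (b :: l) := by
  simp [walkWeight]

@[simp]
theorem walkWeight_singleton (a : V) : D.walkWeight [a] = 0 := by
  simp [walkWeight]

theorem walkWeight_pair (a b : V) : D.walkWeight [a, b] = D.weight a b := by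
  simp [walkWeight]

theorem walkWeight_triple (a b c : V) :
    D.walkWeight [a, b, c] = D.weight a b + D.weight b c := by
  simp [walkWeight]

variable {D}

/-- A potential `d` with the triangle inequality that bounds the weights of the edges from below
bounds the shortest distances from below. -/
theorem le_shortestDist (d : V → V → ℝ) (hd : ∀ u, d u u ≤ 0)
    (htri : ∀ u v w, d u w ≤ d u v + d v w) (hle : ∀ u v, D.Adj u v → d u v ≤ D.weight u v)
    (hD : D.StronglyConnected) (u v : V) : d u v ≤ D.shortestDist u v := by
  have key : ∀ γ u, D.IsWalkFromTo u v γ → d u v ≤ D.walkWeight γ := by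
    intro γ
    induction γ with
    | nil => rintro u ⟨⟨h, -⟩, -⟩; exact absurd rfl h
    | cons a l ih =>
      rintro u ⟨⟨-, hc⟩, hh, hl⟩
      obtain rfl : a = u := by simpa using hh
      cases l with
      | nil =>
        obtain rfl : a = v := by simpa using hl
        simpa using hd a
      | cons b l =>
        rw [List.isChain_cons_cons] at hc
        have h1 := ih b ⟨⟨by simp, hc.2⟩, rfl, by simpa using hl⟩
        rw [walkWeight_cons_cons, NNReal.coe_add]
        linarith [htri a b v, hle a b hc.1]
  -- A walk has to exist: otherwise the infimum would be that of the empty set, which is `0`.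
  obtain ⟨γ₀, h₀⟩ := hD u v
  have h1 : (d u v).toNNReal ≤ D.shortestDist u v :=
    le_csInf ⟨_, γ₀, h₀, rfl⟩ (by
      rintro _ ⟨γ, hγ, rfl⟩
      exact Real.toNNReal_le_iff_le_coe.2 (key γ u hγ))
  exact Real.toNNReal_le_iff_le_coe.1 h1

theorem shortestDist_le {u v : V} {γ : List V} (h : D.IsWalkFromTo u v γ) :
    D.shortestDist u v ≤ D.walkWeight γ :=
  csInf_le (OrderBot.bddBelow _) ⟨γ, h, rfl⟩

theorem shortestDist_le_weight_add (hD : D.StronglyConnected) {u v : V} (h : D.Adj u v) (w : V) :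
    D.shortestDist u w ≤ D.weight u v + D.shortestDist v w := by
  obtain ⟨γ₀, h₀⟩ := hD v w
  rw [← tsub_le_iff_left]
  refine le_csInf ⟨_, γ₀, h₀, rfl⟩ ?_
  rintro _ ⟨γ, ⟨⟨h0, hc⟩, hh, hl⟩, rfl⟩
  rw [tsub_le_iff_left]
  cases γ with
  | nil => exact absurd rfl h0
  | cons a l =>
    obtain rfl : a = v := by simpa using hh
    rw [← walkWeight_cons_cons]
    exact shortestDist_le ⟨⟨by simp, List.isChain_cons_cons.2 ⟨h, hc⟩⟩, rfl, by simpa using hl⟩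

theorem shortestDist_triangle (hD : D.StronglyConnected) (u v w : V) :
    D.shortestDist u w ≤ D.shortestDist u v + D.shortestDist v w := by
  have key : ∀ γ u, D.IsWalkFromTo u v γ →
      D.shortestDist u w ≤ D.walkWeight γ + D.shortestDist v w := by
    intro γ
    induction γ with
    | nil => rintro u ⟨⟨h, -⟩, -⟩; exact absurd rfl h
    | cons a l ih =>
      rintro u ⟨⟨-, hc⟩, hh, hl⟩
      obtain rfl : a = u := by simpa using hh
      cases l with
      | nil =>
        obtain rfl : a = v := by simpa using hl
        exact le_add_self
      | cons b l =>
        rw [List.isChain_cons_cons] at hc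
        rw [walkWeight_cons_cons, add_assoc]
        exact (shortestDist_le_weight_add hD hc.1 w).trans
          (add_le_add_right (ih b ⟨⟨by simp, hc.2⟩, rfl, by simpa using hl⟩) _)
  obtain ⟨γ₀, h₀⟩ := hD u v
  rw [← tsub_le_iff_right]
  refine le_csInf ⟨_, γ₀, h₀, rfl⟩ ?_
  rintro _ ⟨γ, hγ, rfl⟩
  exact tsub_le_iff_right.2 (key γ u hγ)

theorem walkWeight_le_of_sublist (htri : ∀ u v w, D.weight u w ≤ D.weight u v + D.weight v w)
    {l₁ l₂ : List V} (h : l₁.Sublist l₂) : D.walkWeight l₁ ≤ D.walkWeight l₂ := by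
  have htail : ∀ a l, D.walkWeight l ≤ D.walkWeight (a :: l) := by
    intro a l
    cases l with
    | nil => simp [walkWeight]
    | cons b l => rw [walkWeight_cons_cons]; exact le_add_self
  have hskip : ∀ a b l, D.walkWeight (a :: l) ≤ D.walkWeight (a :: b :: l) := by
    intro a b l
    cases l with
    | nil => simp [walkWeight]
    | cons c l =>
      rw [walkWeight_cons_cons, walkWeight_cons_cons, walkWeight_cons_cons, ← add_assoc]
      exact add_le_add_left (htri a b c) _
  -- Deleting an inner vertex replaces two edges by one, which involves the predecessor; the
  -- induction therefore carries an arbitrary vertex `a` in front.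
  suffices D.walkWeight l₁ ≤ D.walkWeight l₂ ∧
      ∀ a, D.walkWeight (a :: l₁) ≤ D.walkWeight (a :: l₂) from this.1
  induction h with
  | slnil => exact ⟨le_rfl, fun _ => le_rfl⟩
  | cons b _ ih => exact ⟨ih.1.trans (htail b _), fun a => (ih.2 a).trans (hskip a b _)⟩
  | cons_cons b _ ih =>
    refine ⟨ih.2 b, fun a => ?_⟩
    rw [walkWeight_cons_cons, walkWeight_cons_cons]
    exact add_le_add_right (ih.2 b) _

/-- Picks one visit to each prescribed vertex, in the order of the walk. With
`walkWeight_le_of_sublist` this reduces lower bounds on walks to finitely many orders of visits. -/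
theorem exists_perm_sublist {l l' : List V} (hl' : l'.Nodup) (h : ∀ v ∈ l', v ∈ l) :
    ∃ m : List V, m.Perm l' ∧ m.Sublist l := by
  obtain ⟨m, h1, h2⟩ := List.subperm_of_subset hl' h
  exact ⟨m, h1, h2⟩

theorem weight_le_walkWeight_of_mem (htri : ∀ u v w, D.weight u w ≤ D.weight u v + D.weight v w)
    {a b : V} (hab : a ≠ b) {γ : List V} (ha : a ∈ γ) (hb : b ∈ γ) :
    D.weight a b ≤ D.walkWeight γ ∨ D.weight b a ≤ D.walkWeight γ := by
  obtain ⟨m, hm, hs⟩ := exists_perm_sublist (l := γ) (l' := [a, b]) (by simp [hab])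
    (by simp [ha, hb])
  have h := walkWeight_le_of_sublist htri hs
  rw [← List.mem_permutations] at hm
  simp [List.permutations, List.permutationsAux, List.permutationsAux.rec,
    List.permutationsAux2] at hm
  rcases hm with rfl | rfl
  · left; rwa [walkWeight_pair] at h
  · right; rwa [walkWeight_pair] at h

theorem weight_add_weight_le_walkWeight_of_mem
    (htri : ∀ u v w, D.weight u w ≤ D.weight u v + D.weight v w) {a b c : V} (hab : a ≠ b)
    (hac : a ≠ c) (hbc : b ≠ c) {γ : List V} (ha : a ∈ γ) (hb : b ∈ γ) (hc : c ∈ γ) :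
    ∃ x y z, [x, y, z].Perm [a, b, c] ∧ D.weight x y + D.weight y z ≤ D.walkWeight γ := by
  obtain ⟨m, hm, hs⟩ := exists_perm_sublist (l := γ) (l' := [a, b, c]) (by simp [hab, hac, hbc])
    (by simp [ha, hb, hc])
  obtain ⟨x, y, z, rfl⟩ := List.length_eq_three.1 hm.length_eq
  exact ⟨x, y, z, hm, by simpa [walkWeight_triple] using walkWeight_le_of_sublist htri hs⟩

end Walks

section Filtrations

variable {V : Type*} {D : WeightedDigraph V} {t : ℝ} {σ : Finset V}

theorem le_of_walkLength_le {c : ℝ} (h : D.walkLength σ ≤ (t : EReal))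
    (hc : ∀ γ, (∀ v ∈ σ, v ∈ γ) → c ≤ D.walkWeight γ) : c ≤ t :=
  EReal.coe_le_coe_iff.1 ((le_iInf₂ fun γ hγ => EReal.coe_le_coe_iff.2 (hc γ hγ.2)).trans h)

theorem walkLength_le_of_walk {γ : List V} (hγ : D.IsWalk γ) (hσ : ∀ v ∈ σ, v ∈ γ)
    (h : D.walkWeight γ ≤ t) : D.walkLength σ ≤ (t : EReal) :=
  (iInf₂_le γ ⟨hγ, hσ⟩).trans (EReal.coe_le_coe_iff.2 h)

end Filtrations

end WeightedDigraph

/-! ### Distances in the modified cycle graph -/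

open WeightedDigraph

/-- A lower bound for the shortest distances in the modified cycle graph on `0, …, n - 1`, exact for
`W = n - 2`. -/
def cycleDist (n i j : ℕ) : ℕ :=
  if i = 0 ∧ j + 1 = n then 1 else if i ≤ j then j - i else (n - 2) + (n - 1 - i) + j

theorem cycleDist_triangle {n : ℕ} (hn : 3 ≤ n) (u v w : Fin n) :
    cycleDist n u w ≤ cycleDist n u v + cycleDist n v w := by
  have := u.isLt
  have := v.isLt
  have := w.isLt
  unfold cycleDist
  split_ifs <;> omega

section Network

variable {n : ℕ} (hn : 3 ≤ n) {W : ℝ≥0} (hW : (n : ℝ) - 2 ≤ W)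

/-- `cycleDist` serves as the potential in `le_shortestDist`; the bound `n - 2 ≤ W` is what the edge
from `n - 1` to `0` requires. -/
theorem cycleDist_le_weight (u v : Fin n) :
    (cycleDist n u v : ℝ) ≤ (modifiedCycleNetwork n hn W hW).weight u v := by
  refine le_shortestDist (D := modifiedCycle n hn W hW) (fun u v => (cycleDist n u v : ℝ))
    (fun u => ?_) (fun u v w => ?_) (fun u v h => ?_)
    (modifiedCycle_stronglyConnected n hn W hW) u v
  · have : cycleDist n u u = 0 := by
      unfold cycleDist
      split_ifs <;> omega
    simp [this]
  · exact_mod_cast cycleDist_triangle hn u v w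
  · change _ ≤ (((if u.val + 1 = n ∧ v.val = 0 then W else 1 : ℝ≥0)) : ℝ)
    have h' : u.val + 1 = v.val ∨ (u.val = 0 ∧ v.val + 1 = n) ∨ (u.val + 1 = n ∧ v.val = 0) := h
    split_ifs with hb
    · have : cycleDist n u v = n - 2 := by
        unfold cycleDist
        split_ifs <;> omega
      rw [this, Nat.cast_sub (by omega)]
      exact_mod_cast hW
    · have : cycleDist n u v = 1 := by
        unfold cycleDist
        split_ifs <;> omega
      simp [this]

theorem exists_path (u v : Fin n) (huv : u ≤ v) :
    ∃ γ : List (Fin n), γ ≠ [] ∧ γ.IsChain (fun i j => i.val + 1 = j.val) ∧ γ.head? = some u ∧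
      γ.getLast? = some v ∧ (∀ w, u ≤ w → w ≤ v → w ∈ γ) ∧ γ.length + u.val = v.val + 1 := by
  obtain ⟨d, hd⟩ : ∃ d, u.val + d = v.val := ⟨v.val - u.val, by have := Fin.le_def.1 huv; omega⟩
  induction d generalizing u with
  | zero =>
    obtain rfl : u = v := Fin.ext hd
    exact ⟨[u], by simp, by simp, rfl, rfl, fun w h1 h2 => by simp [le_antisymm h2 h1],
      by simp; omega⟩
  | succ d ih =>
    obtain ⟨γ, h0, h1, h2, h3, h4, h5⟩ := ih ⟨u.val + 1, by omega⟩
      (Fin.le_def.2 (by simp only; omega)) (by simp only; omega)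
    refine ⟨u :: γ, by simp, ?_, rfl, ?_, fun w hw1 hw2 => ?_, ?_⟩
    · rw [List.isChain_cons]
      refine ⟨fun y hy => ?_, h1⟩
      rw [h2] at hy
      obtain rfl := Option.mem_some_iff.1 hy
      rfl
    · rw [List.getLast?_cons_of_ne_nil h0, h3]
    · rcases eq_or_lt_of_le hw1 with rfl | h
      · simp
      · exact List.mem_cons_of_mem _ (h4 w (Fin.le_def.2 (Fin.lt_def.1 h)) hw2)
    · simp only [List.length_cons] at h5 ⊢
      omega

/-- A list of vertices has one edge fewer than entries; the `+ 1` avoids truncated subtraction. -/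
theorem walkWeight_add_one_le_length (D : WeightedDigraph (Fin n))
    (hD : ∀ u v : Fin n, u.val + 1 = v.val → D.weight u v ≤ 1) {γ : List (Fin n)} (h0 : γ ≠ [])
    (h1 : γ.IsChain (fun i j => i.val + 1 = j.val)) : D.walkWeight γ + 1 ≤ γ.length := by
  induction γ with
  | nil => exact absurd rfl h0
  | cons a l ih =>
    cases l with
    | nil => simp
    | cons b l =>
      rw [List.isChain_cons_cons] at h1
      rw [walkWeight_cons_cons, List.length_cons, Nat.cast_succ, add_assoc, add_comm]
      exact add_le_add (ih (by simp) h1.2) (hD _ _ h1.1)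

theorem weight_add_le_of_le {u v : Fin n} (huv : u ≤ v) :
    ((modifiedCycleNetwork n hn W hW).weight u v : ℝ) + u.val ≤ v.val := by
  obtain ⟨γ, h0, h1, h2, h3, -, h5⟩ := exists_path u v huv
  have hw : (modifiedCycleNetwork n hn W hW).weight u v ≤
      (modifiedCycle n hn W hW).walkWeight γ :=
    shortestDist_le ⟨⟨h0, h1.imp fun _ _ h => Or.inl h⟩, h2, h3⟩
  have hl := walkWeight_add_one_le_length (modifiedCycle n hn W hW) (fun u v h => by
    change (if u.val + 1 = n ∧ v.val = 0 then W else 1) ≤ 1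
    rw [if_neg (by omega)]) h0 h1
  have h6 : (γ.length : ℝ) + u.val = v.val + 1 := by exact_mod_cast h5
  have h7 : (((modifiedCycleNetwork n hn W hW).weight u v : ℝ)) + 1 ≤ γ.length := by
    exact_mod_cast (add_le_add_left hw 1).trans hl
  linarith

theorem weight_zero_last_le {u v : Fin n} (hu : u.val = 0) (hv : v.val + 1 = n) :
    ((modifiedCycleNetwork n hn W hW).weight u v : ℝ) ≤ 1 := by
  have hw : (modifiedCycleNetwork n hn W hW).weight u v ≤
      (modifiedCycle n hn W hW).walkWeight [u, v] :=
    shortestDist_le ⟨⟨by simp, by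
      rw [List.isChain_pair]; exact Or.inr (Or.inl ⟨hu, hv⟩)⟩, rfl, rfl⟩
  have : (modifiedCycle n hn W hW).weight u v = 1 := by
    change (if u.val + 1 = n ∧ v.val = 0 then W else 1) = 1
    rw [if_neg (by omega)]
  rw [walkWeight_pair, this] at hw
  exact_mod_cast hw

theorem network_triangle (u v w : Fin n) : (modifiedCycleNetwork n hn W hW).weight u w ≤
    (modifiedCycleNetwork n hn W hW).weight u v + (modifiedCycleNetwork n hn W hW).weight v w :=
  shortestDist_triangle (modifiedCycle_stronglyConnected n hn W hW) u v w

end Network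

/-! ### The Dowker filtrations -/

section Filtrations

variable {n : ℕ} (hn : 3 ≤ n) {W : ℝ≥0} (hW : (n : ℝ) - 2 ≤ W) {t : ℝ}

theorem dowkerRel_of_near (ht : 0 ≤ t) {u v : Fin n}
    (h : (u.val ≤ v.val ∧ v.val ≤ u.val + ⌊t⌋₊) ∨ (u.val = 0 ∧ v.val + 1 = n ∧ 1 ≤ ⌊t⌋₊)) :
    (modifiedCycleNetwork n hn W hW).dowkerRel t u v := by
  refine ⟨trivial, ?_⟩
  have hm := Nat.floor_le ht
  rcases h with ⟨h1, h2⟩ | ⟨h1, h2, h3⟩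
  · have := weight_add_le_of_le hn hW (Fin.le_def.2 h1)
    have h4 : (v.val : ℝ) ≤ u.val + ⌊t⌋₊ := by exact_mod_cast h2
    linarith
  · have := weight_zero_last_le hn hW h1 h2
    have h4 : (1 : ℝ) ≤ ⌊t⌋₊ := by exact_mod_cast h3
    linarith

/-- The last alternative stands for all backward pairs, whose distance is at least `n - 2`. Apart
from it this is the converse of `dowkerRel_of_near`, so Dowker simplices become inequalities between
natural numbers. -/
theorem near_of_dowkerRel {u v : Fin n}
    (h : (modifiedCycleNetwork n hn W hW).dowkerRel t u v) :
    (u.val ≤ v.val ∧ v.val ≤ u.val + ⌊t⌋₊) ∨ (u.val = 0 ∧ v.val + 1 = n ∧ 1 ≤ ⌊t⌋₊) ∨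
      n ≤ ⌊t⌋₊ + 2 := by
  have h1 : cycleDist n u v ≤ ⌊t⌋₊ :=
    Nat.le_floor ((cycleDist_le_weight hn hW u v).trans h.2)
  unfold cycleDist at h1
  split_ifs at h1 <;> omega

theorem le_floor_iff_cast_le {k : ℕ} (hk : 1 ≤ k) : (k : ℝ) ≤ t ↔ k ≤ ⌊t⌋₊ :=
  (Nat.le_floor_iff' (by omega)).symm

variable (K : Type*) [Field K]

theorem isPersistenceDiagram_dowkerSink_iff (P : Multiset (EReal × EReal)) :
    (persistentHomology K
      (modifiedCycleNetwork n hn W hW).dowkerSinkFiltration 1).IsPersistenceDiagram P ↔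
        P = if n / 2 = 1 then 0 else {(1, (((n / 2 : ℕ) : ℝ) : EReal))} := by
  have hmem : ∀ (t : ℝ) (σ : Finset (Fin n)) (x x' : Fin n), 0 ≤ t → x ∈ σ → (∀ x ∈ σ,
      (x.val ≤ x'.val ∧ x'.val ≤ x.val + ⌊t⌋₊) ∨ (x.val = 0 ∧ x'.val + 1 = n ∧ 1 ≤ ⌊t⌋₊)) →
      σ ∈ (modifiedCycleNetwork n hn W hW).dowkerSinkFiltration t := fun t σ x x' ht hx h =>
    ⟨⟨x, hx⟩, x', fun y hy => dowkerRel_of_near hn hW ht (h y hy)⟩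
  refine isPersistenceDiagram_iff_of_arcs K _ (n / 2) (by omega) (by omega) ?_ ?_ ?_ ?_ ?_ ?_ P
  · rintro t ht a b hab ⟨-, x', hx'⟩
    have h := Fin.lt_def.1 hab
    have h0 : ⌊t⌋₊ = 0 := Nat.floor_eq_zero.2 ht
    have h1 := near_of_dowkerRel hn hW (hx' a (by simp))
    have h2 := near_of_dowkerRel hn hW (hx' b (by simp))
    omega
  · intro u v huv
    refine hmem 1 _ u v zero_le_one (by simp) fun x hx => ?_
    rw [Nat.floor_one]
    rcases Finset.mem_insert.1 hx with rfl | hx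
    · omega
    · rw [Finset.mem_singleton.1 hx]
      omega
  · intro u v hu hv
    refine hmem 1 _ u v zero_le_one (by simp) fun x hx => ?_
    rw [Nat.floor_one]
    rcases Finset.mem_insert.1 hx with rfl | hx
    · omega
    · rw [Finset.mem_singleton.1 hx]
      omega
  · rintro t ht1 htk a b hab ⟨-, x', hx'⟩
    have h := Fin.lt_def.1 hab
    -- As `n / 2 ≤ n - 2`, this excludes the backward alternative of `near_of_dowkerRel`.
    have hm : ⌊t⌋₊ < n / 2 := by rwa [← not_le, ← le_floor_iff_cast_le (by omega), not_le]
    have h1 := near_of_dowkerRel hn hW (hx' a (by simp))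
    have h2 := near_of_dowkerRel hn hW (hx' b (by simp))
    -- A short edge has its upper end `b` as sink for the whole arc. A long edge can only arise from
    -- the wrap edge, with `a = 0` and `x' = n - 1`, and then `x'` is a sink for `0` and everything
    -- from `b` on.
    refine ⟨fun hk => hmem t _ a b (by linarith) (by simp [hab.le]) fun x hx => ?_,
      fun hk => hmem t _ a x' (by linarith) (by simp) fun x hx => ?_⟩
    · simp only [Finset.mem_Icc, Fin.le_def] at hx
      omega
    · simp only [Finset.mem_union, Finset.mem_Iic, Finset.mem_Ici, Fin.le_def] at hx
      omega
  · rintro t ht1 htk a b c hab hbc ⟨-, x', hx'⟩ hac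
    have h := Fin.lt_def.1 hab
    have h' := Fin.lt_def.1 hbc
    have hm : ⌊t⌋₊ < n / 2 := by rwa [← not_le, ← le_floor_iff_cast_le (by omega), not_le]
    have h1 := near_of_dowkerRel hn hW (hx' a (by simp))
    have h2 := near_of_dowkerRel hn hW (hx' b (by simp))
    have h3 := near_of_dowkerRel hn hW (hx' c (by simp))
    -- A long outer edge forces `a = 0` and `x' = n - 1`. Then `b ≥ n - 1 - ⌊t⌋₊ ≥ n / 2`, so `{a,
    -- b}` is long, while `{b, c}` has length at most `⌊t⌋₊` and is short.
    omega
  · intro t ht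
    have hm := (le_floor_iff_cast_le (by omega)).1 ht
    have ht0 : 0 ≤ t := (Nat.cast_nonneg _).trans ht
    -- The edge `{0, n / 2}` spans both arcs: one has sink `n / 2`, the other has sink `n - 1`, at
    -- distance `n - 1 - n / 2 ≤ n / 2` from `n / 2`.
    refine ⟨fun a b hab hX => ?_, ⟨0, by omega⟩, ⟨n / 2, by omega⟩, Fin.mk_lt_mk.2 (by omega),
      hmem t _ ⟨n / 2, by omega⟩ ⟨n / 2, by omega⟩ ht0 (by simp [Fin.le_def]) fun x hx => ?_,
      hmem t _ ⟨n / 2, by omega⟩ ⟨n - 1, by omega⟩ ht0 (by simp [Fin.le_def]) fun x hx => ?_⟩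
    · obtain ⟨-, x', hx'⟩ := hX
      have h := Fin.lt_def.1 hab
      have h1 := near_of_dowkerRel hn hW (hx' a (by simp))
      have h2 := near_of_dowkerRel hn hW (hx' b (by simp))
      rcases Nat.lt_or_ge (⌊t⌋₊ + 2) n with hlt | hge
      · by_cases hax : a.val ≤ x'.val ∧ x'.val ≤ a.val + ⌊t⌋₊
        · refine Or.inl (hmem t _ a b ht0 (by simp [hab.le]) fun x hx => ?_)
          simp only [Finset.mem_Icc, Fin.le_def] at hx
          omega
        · refine Or.inr (hmem t _ a x' ht0 (by simp) fun x hx => ?_)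
          simp only [Finset.mem_union, Finset.mem_Iic, Finset.mem_Ici, Fin.le_def] at hx
          omega
      -- Once `⌊t⌋₊ ≥ n - 2`, the vertex `n - 1` is a sink for all vertices: directly from `1` on,
      -- and for `0` by the wrap edge.
      · refine Or.inl (hmem t _ a ⟨n - 1, by omega⟩ ht0 (by simp [hab.le]) fun x hx => ?_)
        simp only
        omega
    · simp only [Finset.mem_Icc, Fin.le_def] at hx ⊢
      omega
    · simp only [Finset.mem_union, Finset.mem_Iic, Finset.mem_Ici, Fin.le_def] at hx ⊢
      omega

/-- Mirror image of the sink case: reversing all edges and exchanging `v` with `n - 1 - v` preserves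
the graph. The lower end `a` is now the source of a short arc, and `0` that of the arc of a long
edge, which ends at `n - 1`. -/
theorem isPersistenceDiagram_dowkerSource_iff (P : Multiset (EReal × EReal)) :
    (persistentHomology K
      (modifiedCycleNetwork n hn W hW).dowkerSourceFiltration 1).IsPersistenceDiagram P ↔
        P = if n / 2 = 1 then 0 else {(1, (((n / 2 : ℕ) : ℝ) : EReal))} := by
  have hmem : ∀ (t : ℝ) (σ : Finset (Fin n)) (x x' : Fin n), 0 ≤ t → x ∈ σ → (∀ x ∈ σ,
      (x'.val ≤ x.val ∧ x.val ≤ x'.val + ⌊t⌋₊) ∨ (x'.val = 0 ∧ x.val + 1 = n ∧ 1 ≤ ⌊t⌋₊)) →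
      σ ∈ (modifiedCycleNetwork n hn W hW).dowkerSourceFiltration t := fun t σ x x' ht hx h =>
    ⟨⟨x, hx⟩, x', fun y hy => dowkerRel_of_near hn hW ht (h y hy)⟩
  refine isPersistenceDiagram_iff_of_arcs K _ (n / 2) (by omega) (by omega) ?_ ?_ ?_ ?_ ?_ ?_ P
  · rintro t ht a b hab ⟨-, x', hx'⟩
    have h := Fin.lt_def.1 hab
    have h0 : ⌊t⌋₊ = 0 := Nat.floor_eq_zero.2 ht
    have h1 := near_of_dowkerRel hn hW (hx' a (by simp))
    have h2 := near_of_dowkerRel hn hW (hx' b (by simp))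
    omega
  · intro u v huv
    refine hmem 1 _ u u zero_le_one (by simp) fun x hx => ?_
    rw [Nat.floor_one]
    rcases Finset.mem_insert.1 hx with rfl | hx
    · omega
    · rw [Finset.mem_singleton.1 hx]
      omega
  · intro u v hu hv
    refine hmem 1 _ u u zero_le_one (by simp) fun x hx => ?_
    rw [Nat.floor_one]
    rcases Finset.mem_insert.1 hx with rfl | hx
    · omega
    · rw [Finset.mem_singleton.1 hx]
      omega
  · rintro t ht1 htk a b hab ⟨-, x', hx'⟩
    have h := Fin.lt_def.1 hab
    have hm : ⌊t⌋₊ < n / 2 := by rwa [← not_le, ← le_floor_iff_cast_le (by omega), not_le]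
    have h1 := near_of_dowkerRel hn hW (hx' a (by simp))
    have h2 := near_of_dowkerRel hn hW (hx' b (by simp))
    refine ⟨fun hk => hmem t _ a a (by linarith) (by simp [hab.le]) fun x hx => ?_,
      fun hk => hmem t _ a x' (by linarith) (by simp) fun x hx => ?_⟩
    · simp only [Finset.mem_Icc, Fin.le_def] at hx
      omega
    · simp only [Finset.mem_union, Finset.mem_Iic, Finset.mem_Ici, Fin.le_def] at hx
      omega
  · rintro t ht1 htk a b c hab hbc ⟨-, x', hx'⟩ hac
    have h := Fin.lt_def.1 hab
    have h' := Fin.lt_def.1 hbc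
    have hm : ⌊t⌋₊ < n / 2 := by rwa [← not_le, ← le_floor_iff_cast_le (by omega), not_le]
    have h1 := near_of_dowkerRel hn hW (hx' a (by simp))
    have h2 := near_of_dowkerRel hn hW (hx' b (by simp))
    have h3 := near_of_dowkerRel hn hW (hx' c (by simp))
    omega
  · intro t ht
    have hm := (le_floor_iff_cast_le (by omega)).1 ht
    have ht0 : 0 ≤ t := (Nat.cast_nonneg _).trans ht
    refine ⟨fun a b hab hX => ?_, ⟨n - 1 - n / 2, by omega⟩, ⟨n - 1, by omega⟩,
      Fin.mk_lt_mk.2 (by omega),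
      hmem t _ ⟨n - 1, by omega⟩ ⟨n - 1 - n / 2, by omega⟩ ht0 (by simp [Fin.le_def])
        fun x hx => ?_,
      hmem t _ ⟨n - 1, by omega⟩ ⟨0, by omega⟩ ht0 (by simp) fun x hx => ?_⟩
    · obtain ⟨-, x', hx'⟩ := hX
      have h := Fin.lt_def.1 hab
      have h1 := near_of_dowkerRel hn hW (hx' a (by simp))
      have h2 := near_of_dowkerRel hn hW (hx' b (by simp))
      rcases Nat.lt_or_ge (⌊t⌋₊ + 2) n with hlt | hge
      · by_cases hbx : x'.val ≤ b.val ∧ b.val ≤ x'.val + ⌊t⌋₊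
        · refine Or.inl (hmem t _ a a ht0 (by simp [hab.le]) fun x hx => ?_)
          simp only [Finset.mem_Icc, Fin.le_def] at hx
          omega
        · refine Or.inr (hmem t _ a x' ht0 (by simp) fun x hx => ?_)
          simp only [Finset.mem_union, Finset.mem_Iic, Finset.mem_Ici, Fin.le_def] at hx
          omega
      · refine Or.inl (hmem t _ a ⟨0, by omega⟩ ht0 (by simp [hab.le]) fun x hx => ?_)
        change (0 ≤ x.val ∧ x.val ≤ 0 + ⌊t⌋₊) ∨ (0 = 0 ∧ x.val + 1 = n ∧ 1 ≤ ⌊t⌋₊)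
        omega
    · simp only [Finset.mem_Icc, Fin.le_def] at hx ⊢
      omega
    · simp only [Finset.mem_union, Finset.mem_Iic, Finset.mem_Ici, Fin.le_def] at hx
      change (0 ≤ x.val ∧ x.val ≤ 0 + ⌊t⌋₊) ∨ (0 = 0 ∧ x.val + 1 = n ∧ 1 ≤ ⌊t⌋₊)
      omega

/-! ### The walk-length filtration -/

theorem isChain_network (γ : List (Fin n)) : γ.IsChain (modifiedCycleNetwork n hn W hW).Adj :=
  List.isChain_iff_getElem.2 fun _ _ => trivial

theorem Icc_mem_walkLengthFiltration {a b : Fin n} (hab : a ≤ b) (ht : (b.val : ℝ) ≤ t + a.val) :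
    Finset.Icc a b ∈ (modifiedCycleNetwork n hn W hW).walkLengthFiltration t := by
  obtain ⟨γ, h0, h1, -, -, h4, h5⟩ := exists_path a b hab
  refine ⟨⟨a, by simp [hab]⟩, walkLength_le_of_walk ⟨h0, isChain_network hn hW γ⟩
    (fun v hv => h4 v (Finset.mem_Icc.1 hv).1 (Finset.mem_Icc.1 hv).2) ?_⟩
  have h6 : (((modifiedCycleNetwork n hn W hW).walkWeight γ : ℝ)) + 1 ≤ γ.length := by
    exact_mod_cast walkWeight_add_one_le_length _ (fun u v huv => by
      have h := weight_add_le_of_le hn hW (Fin.le_def.2 (by omega : u.val ≤ v.val))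
      have huv' : (u.val : ℝ) + 1 = v.val := by exact_mod_cast huv
      have h' : ((modifiedCycleNetwork n hn W hW).weight u v : ℝ) ≤ 1 := by linarith
      exact_mod_cast h') h0 h1
  have h7 : (γ.length : ℝ) + a.val = b.val + 1 := by exact_mod_cast h5
  linarith

theorem ends_mem_walkLengthFiltration {a b : Fin n} (ha : a.val = 0) (hb : b.val + 1 = n)
    (ht : 1 ≤ t) : {a, b} ∈ (modifiedCycleNetwork n hn W hW).walkLengthFiltration t := by
  refine ⟨⟨a, by simp⟩, walkLength_le_of_walk (γ := [a, b])
    ⟨by simp, isChain_network hn hW _⟩ (by simp) ?_⟩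
  rw [walkWeight_pair]
  exact (weight_zero_last_le hn hW ha hb).trans ht

theorem le_of_pair_mem_walkLengthFiltration {a b : Fin n} (hab : a ≠ b) {c : ℕ}
    (h : {a, b} ∈ (modifiedCycleNetwork n hn W hW).walkLengthFiltration t)
    (h1 : c ≤ cycleDist n a b) (h2 : c ≤ cycleDist n b a) : (c : ℝ) ≤ t := by
  refine le_of_walkLength_le h.2 fun γ hγ => ?_
  have h1' : (c : ℝ) ≤ cycleDist n a b := by exact_mod_cast h1
  have h2' : (c : ℝ) ≤ cycleDist n b a := by exact_mod_cast h2
  rcases weight_le_walkWeight_of_mem (network_triangle hn hW) hab (hγ a (by simp))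
    (hγ b (by simp)) with h | h
  · exact (h1'.trans (cycleDist_le_weight hn hW a b)).trans (NNReal.coe_le_coe.2 h)
  · exact (h2'.trans (cycleDist_le_weight hn hW b a)).trans (NNReal.coe_le_coe.2 h)

theorem le_of_triple_mem_walkLengthFiltration {a b c : Fin n} (hab : a < b) (hbc : b < c)
    (ha : a.val = 0) (hc : c.val + 1 = n)
    (h : {a, b, c} ∈ (modifiedCycleNetwork n hn W hW).walkLengthFiltration t) :
    ((n - 1 : ℕ) : ℝ) ≤ t := by
  refine le_of_walkLength_le h.2 fun γ hγ => ?_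
  obtain ⟨x, y, z, hp, hw⟩ := weight_add_weight_le_walkWeight_of_mem (network_triangle hn hW)
    hab.ne (hab.trans hbc).ne hbc.ne (hγ a (by simp)) (hγ b (by simp)) (hγ c (by simp))
  have ha' : a = x ∨ a = y ∨ a = z := by simpa using hp.symm.subset (by simp : a ∈ [a, b, c])
  have hc' : c = x ∨ c = y ∨ c = z := by simpa using hp.symm.subset (by simp : c ∈ [a, b, c])
  have hnd : [x, y, z].Nodup := hp.nodup_iff.2 (by simp [hab.ne, (hab.trans hbc).ne, hbc.ne])
  simp only [List.nodup_cons, List.mem_cons, List.not_mem_nil, or_false, not_or,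
    Fin.ext_iff] at hnd ha' hc'
  -- Checked for each order of visits. In increasing order the sum is exactly `n - 1`; any other
  -- order goes backwards, at cost at least `n - 2`, and makes at least one more step.
  have hd : n - 1 ≤ cycleDist n x y + cycleDist n y z := by
    unfold cycleDist
    split_ifs <;> omega
  have hd' : ((n - 1 : ℕ) : ℝ) ≤ cycleDist n x y + cycleDist n y z := by exact_mod_cast hd
  have h1 := cycleDist_le_weight hn hW x y
  have h2 := cycleDist_le_weight hn hW y z
  have hw' : ((modifiedCycleNetwork n hn W hW).weight x y : ℝ) +
      (modifiedCycleNetwork n hn W hW).weight y z ≤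
      (modifiedCycleNetwork n hn W hW).walkWeight γ := by exact_mod_cast hw
  linarith

theorem isPersistenceDiagram_walkLength_iff (P : Multiset (EReal × EReal)) :
    (persistentHomology K
      (modifiedCycleNetwork n hn W hW).walkLengthFiltration 1).IsPersistenceDiagram P ↔
        P = {(1, (((n - 1 : ℕ) : ℝ) : EReal))} := by
  rw [isPersistenceDiagram_iff_of_arcs K _ (n - 1) (by omega) le_rfl ?_ ?_ ?_ ?_ ?_ ?_ P,
    if_neg (by omega)]
  · intro t ht a b hab hX
    have h := Fin.lt_def.1 hab
    have := le_of_pair_mem_walkLengthFiltration hn hW (c := 1) hab.ne hX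
      (by unfold cycleDist; split_ifs <;> omega) (by unfold cycleDist; split_ifs <;> omega)
    rw [Nat.cast_one] at this
    linarith
  · intro u v huv
    have huv' : (v.val : ℝ) = 1 + u.val := by rw [← huv]; push_cast; ring
    convert Icc_mem_walkLengthFiltration hn hW (a := u) (b := v) (t := 1)
      (Fin.le_def.2 (by omega)) huv'.le using 1
    ext x
    simp only [Finset.mem_insert, Finset.mem_singleton, Finset.mem_Icc, Fin.le_def, Fin.ext_iff]
    omega
  · intro u v hu hv
    exact ends_mem_walkLengthFiltration hn hW hu (by omega) le_rfl
  · intro t ht1 htk a b hab hX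
    have h := Fin.lt_def.1 hab
    refine ⟨fun hk => ?_, fun hk => ?_⟩
    -- For a short edge both directions cost at least `b - a`, so `b - a ≤ t` and walking straight
    -- from `a` to `b` is affordable.
    · have := le_of_pair_mem_walkLengthFiltration hn hW (c := b.val - a.val) hab.ne hX
        (by unfold cycleDist; split_ifs <;> omega) (by unfold cycleDist; split_ifs <;> omega)
      rw [Nat.cast_sub h.le] at this
      exact Icc_mem_walkLengthFiltration hn hW hab.le (by linarith)
    -- With `k = n - 1` the only long edge is `{0, n - 1}`, which is its own complementary arc.
    · convert hX using 1
      ext x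
      simp only [Finset.mem_insert, Finset.mem_singleton, Finset.mem_union, Finset.mem_Iic,
        Finset.mem_Ici, Fin.le_def, Fin.ext_iff]
      omega
  · intro t ht1 htk a b c hab hbc hX hac
    -- No triangle contains the wrap edge before time `n - 1`, so the cocycle condition is vacuous.
    have := le_of_triple_mem_walkLengthFiltration hn hW hab hbc (by omega) (by omega) hX
    linarith
  · intro t ht
    -- The walk `0, 1, …, n - 1` visits everything at weight at most `n - 1`, so the complex is the
    -- full simplex.
    have hall : ∀ (σ : Finset (Fin n)) (x : Fin n), x ∈ σ →
        σ ∈ (modifiedCycleNetwork n hn W hW).walkLengthFiltration t := fun σ x hx =>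
      PreAbstractSimplicialComplex.mem_of_subset (Icc_mem_walkLengthFiltration hn hW
        (a := ⟨0, by omega⟩) (b := ⟨n - 1, by omega⟩) (Fin.mk_le_mk.2 (by omega))
        (by simpa using ht)) (fun y _ => Finset.mem_Icc.2
          ⟨Fin.le_def.2 (Nat.zero_le _), Fin.le_def.2 (by simp only; omega)⟩) hx
    exact ⟨fun a b hab _ => Or.inl (hall _ a (by simp [hab.le])), ⟨0, by omega⟩, ⟨1, by omega⟩,
      Fin.mk_lt_mk.2 one_pos, hall _ ⟨0, by omega⟩ (by simp), hall _ ⟨0, by omega⟩ (by simp)⟩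

end Filtrations

theorem ceil_sub_one_div_two (n : ℕ) : ⌈((n : ℝ) - 1) / 2⌉ = (n / 2 : ℕ) := by
  rw [Int.ceil_eq_iff]
  have h1 : (n : ℝ) ≤ 2 * (n / 2 : ℕ) + 1 := by exact_mod_cast (by omega : n ≤ 2 * (n / 2) + 1)
  have h2 : (2 : ℝ) * (n / 2 : ℕ) ≤ n := by exact_mod_cast (by omega : 2 * (n / 2) ≤ n)
  constructor
  · rw [Int.cast_natCast]
    linarith
  · rw [Int.cast_natCast]
    linarith

theorem mainTheorem3 (K : Type*) [Field K] (n : ℕ) (hn : 3 ≤ n) (W : ℝ≥0)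
    (hW : (n : ℝ) - 2 ≤ W) :
    (∀ P : Multiset (EReal × EReal),
      (persistentHomology K
        (modifiedCycleNetwork n hn W hW).dowkerSinkFiltration 1).IsPersistenceDiagram P ↔
          P = if n = 3 then 0 else {(1, ((⌈((n : ℝ) - 1) / 2⌉ : ℝ) : EReal))}) ∧
    (∀ P : Multiset (EReal × EReal),
      (persistentHomology K
        (modifiedCycleNetwork n hn W hW).dowkerSourceFiltration 1).IsPersistenceDiagram P ↔
          P = if n = 3 then 0 else {(1, ((⌈((n : ℝ) - 1) / 2⌉ : ℝ) : EReal))}) ∧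
    (∀ P : Multiset (EReal × EReal),
      (persistentHomology K
        (modifiedCycleNetwork n hn W hW).walkLengthFiltration 1).IsPersistenceDiagram P ↔
          P = {(1, (((n : ℝ) - 1 : ℝ) : EReal))}) := by
  have h3 : n / 2 = 1 ↔ n = 3 := by omega
  have h1 : ((n - 1 : ℕ) : ℝ) = (n : ℝ) - 1 := by rw [Nat.cast_sub (by omega), Nat.cast_one]
  simp only [ceil_sub_one_div_two, Int.cast_natCast, ← h3]
  rw [← h1]
  exact ⟨isPersistenceDiagram_dowkerSink_iff hn hW K,
    isPersistenceDiagram_dowkerSource_iff hn hW K, isPersistenceDiagram_walkLength_iff hn hW K⟩
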